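/- Let $\mathcal N=(\mathcal V,\mathcal E)$ be a connected finite oriented graph with $n_{\mathcal V}$ vertices and $n_{\mathcal E}\ge 1$ edges (loops and multiple edges are allowed), whose vertices are points of $\mathbb R^3$. The $i$-th edge ($i=1,\dots,n_{\mathcal E}$) has length $\ell^i>0$ and is the image of a naturally parametrized curve $\Phi^i:[0,\ell^i]\to\mathbb R^3$ running from the vertex it leaves to the vertex it enters: $\Phi^i$ is differentiable on $[0,\ell^i]$ with unit tangent $t^i=(\Phi^i)'$. Let $Q^i(s)=[t^i,n^i,b^i](s)\in SO(3)$ for $s\in[0,\ell^i]$, with measurable entries, and let $H^i=\operatorname{diag}(\mu^iK^i,E^iI^i_n,E^iI^i_b)$ be constant and positive definite. Let $J_j^+$ and $J_j^-$ be the sets of edges that enter and leave the $j$-th vertex. The $i$-th edge is straight if $\Phi^i(s)=\Phi^i(0)+s\tau$ on $[0,\ell^i]$ for some $\tau\in\mathbb R^3$. Assume that, for real numbers $\alpha_i$ indexed by the straight edges, the equations $$\sum_{i\in J^+_j,\ i\text{ straight}}\alpha_i t^i-\sum_{i\in J^-_j,\ i\text{ straight}}\alpha_i t^i=0,\qquad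 j=1,\dots,n_{\mathcal V},$$ imply $\alpha_i=0$ for all straight edges $i$. Put $L^2(\mathcal N;\mathbb R^3)=\prod_i L^2(0,\ell^i;\mathbb R^3)$, $L^2_{H^1}(\mathcal N;\mathbb R^3)=\prod_i H^1(0,\ell^i;\mathbb R^3)$ (no continuity at vertices is imposed), $\int_{\mathcal N}v=\sum_{i=1}^{n_{\mathcal E}}\int_0^{\ell^i}v^i\,ds$, and $$V=L^2(\mathcal N;\mathbb R^3)^2\times(\mathbb R^{3n_{\mathcal E}})^4\times\mathbb R^3\times\mathbb R^3,\qquad M=L^2_{H^1}(\mathcal N;\mathbb R^3)^2\times(\mathbb R^{3n_{\mathcal V}})^2 .$$ Let $A^\pm\in\mathbb R^{3n_{\mathcal V}\times3n_{\mathcal E}}$ be the matrices whose $3\times3$ block $(j,i)$ is the identity if $i\in J_j^\pm$ and zero otherwise. For $\Sigma=(q,p,P_+,P_-,Q_+,Q_-,\alpha,\beta)\in V$, $\Gamma=(\xi,\theta,\Theta_+,\Theta_-,\Xi_+,\Xi_-,\gamma,\delta)\in V$ and $\psi=(v,w,\mathbf V,\mathbf W)\in M$ define $$a(\Sigma,\Gamma)=\sum_i\int_0^{\ell^i}Q^i(H^i)^{-1}(Q^i)^Tq^i\cdot\xi^i\,ds,$$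 $$\begin{aligned}b(\Sigma,\psi)={}&\sum_i\int_0^{\ell^i}\bigl(-p^i\cdot(\partial_sv^i+t^i\times w^i)-q^i\cdot\partial_sw^i\bigr)\,ds\\&+\sum_i\bigl(P^i_+\cdot v^i(\ell^i)-P^i_-\cdot v^i(0)\bigr)+\sum_i\bigl(Q^i_+\cdot w^i(\ell^i)-Q^i_-\cdot w^i(0)\bigr)\\&-(A^+P_+-A^-P_-)\cdot\mathbf V-(A^+Q_+-A^-Q_-)\cdot\mathbf W+\alpha\cdot\int_{\mathcal N}v+\beta\cdot\int_{\mathcal N}w,\end{aligned}$$ and, for a given load density $f\in L^2(\mathcal N;\mathbb R^3)$, $F(\psi)=-\sum_i\int_0^{\ell^i}f^i\cdot v^i\,ds$. Then for every $f\in L^2(\mathcal N;\mathbb R^3)$ there is exactly one $(\Sigma,\varphi)\in V\times M$ such that $$a(\Sigma,\Gamma)+b(\Gamma,\varphi)=0\quad\text{for all }\Gamma\in V,\qquad b(\Sigma,\psi)=F(\psi)\quad\text{for all }\psi\in M .$$ -/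

import Mathlib

open MeasureTheory Set
open scoped ContDiff Matrix

noncomputable section

namespace StentModel

/-! ### Sobolev spaces on an interval -/

/-- Euclidean three-space. -/
abbrev R3 : Type := EuclideanSpace ℝ (Fin 3)

/-- Lebesgue measure on the interval `(0, l)`. -/
abbrev intervalMeasure (l : ℝ) : Measure ℝ := volume.restrict (Ioo 0 l)

/-- The space `L²(0, l; ℝ³)`. -/
abbrev L2 (l : ℝ) : Type := Lp R3 2 (intervalMeasure l)

/-- `g` is the weak derivative of `v` on `(0, l)`: `∫ φ' v = - ∫ φ g` for all test functions
`φ ∈ C_c^∞(0, l)`. -/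
def IsWeakDeriv (l : ℝ) (v g : L2 l) : Prop :=
  ∀ φ : ℝ → ℝ, ContDiff ℝ ∞ φ → HasCompactSupport φ → tsupport φ ⊆ Ioo 0 l →
    ∫ s, deriv φ s • v s ∂(intervalMeasure l) = - ∫ s, φ s • g s ∂(intervalMeasure l)

theorem integrable_L2 {l : ℝ} (v : L2 l) : Integrable v (intervalMeasure l) :=
  (Lp.memLp v).integrable (by norm_num)

theorem integrable_smul_L2 {l : ℝ} {φ : ℝ → ℝ} (h : Continuous φ) (hc : HasCompactSupport φ)
    (v : L2 l) : Integrable (fun s => φ s • v s) (intervalMeasure l) := by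
  obtain ⟨C, hC⟩ := hc.exists_bound_of_continuous h
  exact (integrable_L2 v).bdd_smul C h.aestronglyMeasurable (Filter.Eventually.of_forall hC)

/-- The Sobolev space `H¹(0, l; ℝ³)`: the functions in `L²(0, l; ℝ³)` that have a weak derivative
in `L²(0, l; ℝ³)`. -/
def H1 (l : ℝ) : Submodule ℝ (L2 l) where
  carrier := {v | ∃ g, IsWeakDeriv l v g}
  zero_mem' := by
    refine ⟨0, fun φ _ _ _ => ?_⟩
    have h0 : ∀ ψ : ℝ → ℝ, ∫ s, ψ s • (0 : L2 l) s ∂(intervalMeasure l) = 0 := by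
      intro ψ
      refine integral_eq_zero_of_ae ?_
      filter_upwards [Lp.coeFn_zero R3 2 (intervalMeasure l)] with s hs
      rw [hs, Pi.zero_apply, smul_zero]
    rw [h0, h0, neg_zero]
  add_mem' := by
    rintro v w ⟨g, hg⟩ ⟨k, hk⟩
    refine ⟨g + k, fun φ h1 h2 h3 => ?_⟩
    have hadd : ∀ ψ : ℝ → ℝ, Continuous ψ → HasCompactSupport ψ → ∀ x y : L2 l,
        ∫ s, ψ s • (x + y : L2 l) s ∂(intervalMeasure l)
          = ∫ s, ψ s • x s ∂(intervalMeasure l) + ∫ s, ψ s • y s ∂(intervalMeasure l) := by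
      intro ψ hψ hc x y
      rw [← integral_add (integrable_smul_L2 hψ hc x) (integrable_smul_L2 hψ hc y)]
      refine integral_congr_ae ?_
      filter_upwards [Lp.coeFn_add x y] with s hs
      rw [hs, Pi.add_apply, smul_add]
    rw [hadd _ (h1.continuous_deriv (by simp)) h2.deriv, hadd _ h1.continuous h2,
      hg φ h1 h2 h3, hk φ h1 h2 h3, neg_add]
  smul_mem' := by
    rintro c v ⟨g, hg⟩
    refine ⟨c • g, fun φ h1 h2 h3 => ?_⟩
    have hsm : ∀ ψ : ℝ → ℝ, ∀ x : L2 l,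
        ∫ s, ψ s • (c • x : L2 l) s ∂(intervalMeasure l)
          = c • ∫ s, ψ s • x s ∂(intervalMeasure l) := by
      intro ψ x
      rw [← integral_smul]
      refine integral_congr_ae ?_
      filter_upwards [Lp.coeFn_smul c x] with s hs
      rw [hs, Pi.smul_apply, smul_comm]
    rw [hsm, hsm, hg φ h1 h2 h3, smul_neg]

/-- The weak derivative `∂ₛ v ∈ L²(0, l; ℝ³)` of `v ∈ H¹(0, l; ℝ³)`. -/
def weakDeriv {l : ℝ} (v : H1 l) : L2 l := v.2.choose

theorem weakDeriv_spec {l : ℝ} (v : H1 l) : IsWeakDeriv l v (weakDeriv v) := v.2.choose_spec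

theorem IsWeakDeriv.unique {l : ℝ} {v g k : L2 l} (hg : IsWeakDeriv l v g)
    (hk : IsWeakDeriv l v k) : g = k := by
  have hint : Integrable (fun s => g s - k s) (intervalMeasure l) :=
    (integrable_L2 g).sub (integrable_L2 k)
  have hloc : LocallyIntegrableOn (fun s => g s - k s) (Ioo 0 l) volume :=
    IntegrableOn.locallyIntegrableOn hint
  have h := isOpen_Ioo.ae_eq_zero_of_integral_contDiff_smul_eq_zero hloc (by
    intro φ h1 h2 h3
    have e1 : ∫ s, φ s • (g s - k s) ∂(intervalMeasure l) = 0 := by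
      simp_rw [smul_sub]
      rw [integral_sub (integrable_smul_L2 h1.continuous h2 g)
        (integrable_smul_L2 h1.continuous h2 k), sub_eq_zero, ← neg_inj,
        ← hg φ h1 h2 h3, ← hk φ h1 h2 h3]
    rw [← e1, eq_comm]
    refine setIntegral_eq_integral_of_forall_compl_eq_zero fun s hs => ?_
    rw [image_eq_zero_of_notMem_tsupport fun hh => hs (h3 hh), zero_smul])
  refine Lp.ext ?_
  filter_upwards [(ae_restrict_iff' measurableSet_Ioo).2 h] with s hs
  exact sub_eq_zero.1 hs

/-- Integration by parts of a test function against a primitive. -/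
theorem integral_deriv_smul_primitive {l : ℝ} (g : L2 l) {φ : ℝ → ℝ} (h1 : ContDiff ℝ ∞ φ)
    (h2 : HasCompactSupport φ) (h3 : tsupport φ ⊆ Ioo 0 l) :
    ∫ s, deriv φ s • (∫ x, (Iio s).indicator g x ∂(intervalMeasure l)) ∂(intervalMeasure l)
      = - ∫ s, φ s • g s ∂(intervalMeasure l) := by
  have hd : Continuous (deriv φ) := h1.continuous_deriv (by simp)
  have hdi : Integrable (deriv φ) (intervalMeasure l) :=
    (hd.integrable_of_hasCompactSupport h2.deriv).restrict
  have hprod : Integrable (fun z : ℝ × ℝ => deriv φ z.1 • g z.2)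
      ((intervalMeasure l).prod (intervalMeasure l)) := hdi.smul_prod (integrable_L2 g)
  have hset : MeasurableSet {z : ℝ × ℝ | z.2 < z.1} := measurableSet_lt measurable_snd measurable_fst
  have hind := hprod.indicator hset
  have e : ∀ s x : ℝ, ({z : ℝ × ℝ | z.2 < z.1}).indicator
      (fun z : ℝ × ℝ => deriv φ z.1 • g z.2) (s, x) = deriv φ s • (Iio s).indicator g x := by
    intro s x
    by_cases h : x < s <;> simp [indicator, h]
  have e' : ∀ s x : ℝ, deriv φ s • (Iio s).indicator g x
      = (Ioi x).indicator (deriv φ) s • g x := by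
    intro s x
    by_cases h : x < s <;> simp [indicator, h]
  have hsw := integral_integral_swap (f := fun s x => deriv φ s • (Iio s).indicator g x)
    (hind.congr (Filter.Eventually.of_forall fun z => e z.1 z.2))
  simp_rw [← integral_smul]
  rw [hsw, ← integral_neg]
  refine integral_congr_ae ((ae_restrict_iff' measurableSet_Ioo).2
    (Filter.Eventually.of_forall fun x hx => ?_))
  simp_rw [e', integral_smul_const]
  rw [← neg_smul]
  congr 1
  rw [integral_indicator measurableSet_Ioi, Measure.restrict_restrict measurableSet_Ioi]
  have : Ioi x ∩ Ioo 0 l = Ioo x l := by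
    ext s; simp only [mem_inter_iff, mem_Ioi, mem_Ioo]
    exact ⟨fun h => ⟨h.1, h.2.2⟩, fun h => ⟨h.1, hx.1.trans h.1, h.2⟩⟩
  rw [this, ← integral_Ioc_eq_integral_Ioo, ← intervalIntegral.integral_of_le hx.2.le,
    intervalIntegral.integral_deriv_eq_sub
      (fun s _ => (h1.differentiable (by simp)).differentiableAt)
      (hd.intervalIntegrable _ _),
    image_eq_zero_of_notMem_tsupport fun hh => (lt_irrefl l (h3 hh).2), zero_sub]

/-- The primitive of an `L²` function is continuous. -/
theorem continuous_primitive {l : ℝ} (g : L2 l) :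
    Continuous fun s => ∫ x, (Iio s).indicator g x ∂(intervalMeasure l) := by
  refine continuous_iff_continuousAt.2 fun s₀ => ?_
  refine continuousAt_of_dominated (bound := fun x => ‖g x‖) ?_ ?_ (integrable_L2 g).norm ?_
  · exact Filter.Eventually.of_forall fun s =>
      (integrable_L2 g).aestronglyMeasurable.indicator measurableSet_Iio
  · exact Filter.Eventually.of_forall fun s => Filter.Eventually.of_forall fun x =>
      norm_indicator_le_norm_self _ _
  · have hne : ∀ᵐ x ∂(intervalMeasure l), x ≠ s₀ :=
      ae_restrict_of_ae (Measure.ae_ne volume s₀)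
    filter_upwards [hne] with x hx
    rcases lt_or_gt_of_ne hx with h | h
    · refine ContinuousAt.congr (f := fun _ => g x) continuousAt_const ?_
      filter_upwards [Ioi_mem_nhds h] with s hs
      exact (indicator_of_mem (s := Iio s) hs _).symm
    · refine ContinuousAt.congr (f := fun _ => (0 : R3)) continuousAt_const ?_
      filter_upwards [Iio_mem_nhds h] with s hs
      exact (indicator_of_notMem (s := Iio s) (fun h' : x < s => lt_asymm h' (mem_Iio.1 hs)) _).symm

/-- A function in `H¹(0, l; ℝ³)` is almost everywhere equal to a primitive of its weak
derivative. -/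
theorem exists_eq_primitive {l : ℝ} (v : H1 l) : ∃ C : R3,
    (v : L2 l) =ᵐ[intervalMeasure l]
      fun s => C + ∫ x, (Iio s).indicator (weakDeriv v) x ∂(intervalMeasure l) := by
  rcases le_or_gt l 0 with hl | hl
  · refine ⟨0, ?_⟩
    refine (ae_restrict_iff' measurableSet_Ioo).2 (Filter.Eventually.of_forall fun s hs => ?_)
    exact absurd (hs.1.trans hs.2) (not_lt.2 hl)
  set G : ℝ → R3 := fun s => ∫ x, (Iio s).indicator (weakDeriv v) x ∂(intervalMeasure l) with hG
  have hGc : Continuous G := continuous_primitive _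
  have hGi : Integrable G (intervalMeasure l) :=
    (hGc.integrableOn_Icc (a := 0) (b := l)).mono_set Ioo_subset_Icc_self
  set w : ℝ → R3 := fun s => (v : L2 l) s - G s with hw
  have hwi : Integrable w (intervalMeasure l) := (integrable_L2 _).sub hGi
  have hsm : ∀ {φ : ℝ → ℝ}, Continuous φ → HasCompactSupport φ → ∀ {k : ℝ → R3},
      Integrable k (intervalMeasure l) → Integrable (fun s => φ s • k s) (intervalMeasure l) := by
    intro φ h hc k hk
    obtain ⟨C, hC⟩ := hc.exists_bound_of_continuous h
    exact hk.bdd_smul C h.aestronglyMeasurable (Filter.Eventually.of_forall hC)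
  -- `w` has vanishing weak derivative
  have hw0 : ∀ φ : ℝ → ℝ, ContDiff ℝ ∞ φ → HasCompactSupport φ → tsupport φ ⊆ Ioo 0 l →
      ∫ s, deriv φ s • w s ∂(intervalMeasure l) = 0 := by
    intro φ h1 h2 h3
    have hd : Continuous (deriv φ) := h1.continuous_deriv (by simp)
    simp_rw [hw, smul_sub]
    rw [integral_sub (integrable_smul_L2 hd h2.deriv _) (hsm hd h2.deriv hGi),
      weakDeriv_spec v φ h1 h2 h3, integral_deriv_smul_primitive _ h1 h2 h3, sub_self]
  let b : ContDiffBump (l / 2) := ⟨l / 8, l / 4, by positivity, by linarith⟩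
  have hbc : ContDiff ℝ ∞ (b.normed volume) := b.contDiff_normed
  have hbs : HasCompactSupport (b.normed volume) := b.hasCompactSupport_normed
  have hbt : tsupport (b.normed volume) ⊆ Ioo 0 l := by
    rw [b.tsupport_normed_eq, Real.closedBall_eq_Icc]
    refine fun s hs => ⟨?_, ?_⟩
    · have := hs.1; change l / 2 - l / 4 ≤ s at this; linarith
    · have := hs.2; change s ≤ l / 2 + l / 4 at this; linarith
  set ρ : ℝ → ℝ := b.normed volume with hρ
  have hρ1 : ∫ s, ρ s = 1 := b.integral_normed
  refine ⟨∫ s, ρ s • w s ∂(intervalMeasure l), ?_⟩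
  set C : R3 := ∫ s, ρ s • w s ∂(intervalMeasure l) with hC
  have hci : Integrable (fun _ : ℝ => C) (intervalMeasure l) := integrable_const _
  have hloc : LocallyIntegrableOn (fun s => w s - C) (Ioo 0 l) volume :=
    IntegrableOn.locallyIntegrableOn (hwi.sub hci)
  have hzero : ∀ {ψ : ℝ → ℝ}, tsupport ψ ⊆ Ioo 0 l → ∀ s ∉ Ioo 0 l, ψ s = 0 :=
    fun h3 s hs => image_eq_zero_of_notMem_tsupport fun hh => hs (h3 hh)
  have hfull : ∀ {ψ : ℝ → ℝ}, tsupport ψ ⊆ Ioo 0 l →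
      ∫ s, ψ s ∂(intervalMeasure l) = ∫ s, ψ s := fun h3 =>
    setIntegral_eq_integral_of_forall_compl_eq_zero (hzero h3)
  have h := isOpen_Ioo.ae_eq_zero_of_integral_contDiff_smul_eq_zero hloc (by
    intro ψ h1 h2 h3
    set m : ℝ := ∫ s, ψ s with hm
    set χ : ℝ → ℝ := fun s => ψ s - m * ρ s with hχ
    have hχc : ContDiff ℝ ∞ χ := h1.sub (contDiff_const.mul hbc)
    have hχs : tsupport χ ⊆ tsupport ψ ∪ tsupport ρ := by
      refine closure_minimal (fun s hs => ?_) ((isClosed_tsupport _).union (isClosed_tsupport _))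
      by_contra hcon
      rw [mem_union, not_or] at hcon
      exact hs (by simp [hχ, image_eq_zero_of_notMem_tsupport hcon.1,
        image_eq_zero_of_notMem_tsupport hcon.2])
    have hχt : tsupport χ ⊆ Ioo 0 l := hχs.trans (union_subset h3 hbt)
    have hχk : HasCompactSupport χ :=
      (IsCompact.union h2 hbs).of_isClosed_subset (isClosed_tsupport _) hχs
    have hχ0 : ∫ s, χ s = 0 := by
      simp only [hχ]
      rw [integral_sub (h1.continuous.integrable_of_hasCompactSupport h2)
        ((hbc.continuous.integrable_of_hasCompactSupport hbs).const_mul m),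
        integral_const_mul, hρ1, mul_one, sub_self]
    set φ : ℝ → ℝ := fun s => ∫ x in (0 : ℝ)..s, χ x with hφ
    have hφd : ∀ s, HasDerivAt φ (χ s) s := fun s =>
      intervalIntegral.integral_hasDerivAt_right (hχc.continuous.intervalIntegrable _ _)
        hχc.continuous.aestronglyMeasurable.stronglyMeasurableAtFilter hχc.continuous.continuousAt
    have hφ' : deriv φ = χ := funext fun s => (hφd s).deriv
    have hφc : ContDiff ℝ ∞ φ :=
      contDiff_infty_iff_deriv.2 ⟨fun s => (hφd s).differentiableAt, hφ' ▸ hχc⟩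
    -- enclose the support of `χ` in a compact subinterval
    obtain ⟨a, ha0, c, hcl, hac⟩ : ∃ a, 0 < a ∧ ∃ c, c < l ∧ tsupport χ ⊆ Icc a c := by
      rcases (tsupport χ).eq_empty_or_nonempty with he | hne
      · exact ⟨1, one_pos, l - 1, by linarith, by simp [he]⟩
      · obtain ⟨a, ha, hmin⟩ := hχk.isCompact.exists_isMinOn hne continuousOn_id
        obtain ⟨c, hc, hmax⟩ := hχk.isCompact.exists_isMaxOn hne continuousOn_id
        exact ⟨a, (hχt ha).1, c, (hχt hc).2, fun s hs => ⟨hmin hs, hmax hs⟩⟩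
    have hχz : ∀ s ∉ Icc a c, χ s = 0 := fun s hs =>
      image_eq_zero_of_notMem_tsupport fun hh => hs (hac hh)
    have hφl : ∀ s, s ∉ Icc a c → φ s = 0 := by
      intro s hs
      rcases lt_or_ge s a with h | h
      · refine intervalIntegral.integral_zero_ae (Filter.Eventually.of_forall fun x hx => ?_)
        refine hχz x fun hx' => ?_
        have : x ≤ max 0 s := hx.2
        have : max 0 s < a := max_lt ha0 h
        linarith [hx'.1]
      · have hcs : c < s := by
          by_contra hcon
          exact hs ⟨h, not_lt.1 hcon⟩
        rw [← hχ0]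
        simp only [hφ]
        rw [intervalIntegral.integral_of_le (ha0.le.trans h)]
        refine setIntegral_eq_integral_of_forall_compl_eq_zero fun x hx => hχz x fun hx' => hx ?_
        exact ⟨ha0.trans_le hx'.1, hx'.2.trans hcs.le⟩
    have hφt : tsupport φ ⊆ Icc a c := closure_minimal (fun s hs => by
      by_contra hcon
      exact hs (hφl s hcon)) isClosed_Icc
    have key := hw0 φ hφc (isCompact_Icc.of_isClosed_subset (isClosed_tsupport _) hφt)
      (hφt.trans fun s hs => ⟨ha0.trans_le hs.1, hs.2.trans_lt hcl⟩)
    rw [hφ'] at key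
    simp only [hχ, sub_smul, mul_smul] at key
    have hρw : Integrable (fun s => m • ρ s • w s) (intervalMeasure l) :=
      (hsm hbc.continuous hbs hwi).smul m
    rw [integral_sub (hsm h1.continuous h2 hwi) hρw,
      integral_smul, ← hC, sub_eq_zero] at key
    have e1 : ∫ s, ψ s • (w s - C) ∂(intervalMeasure l) = 0 := by
      simp_rw [smul_sub]
      rw [integral_sub (hsm h1.continuous h2 hwi) (hsm h1.continuous h2 hci), key,
        integral_smul_const, hfull h3, sub_self]
    rw [← e1, eq_comm]
    exact setIntegral_eq_integral_of_forall_compl_eq_zero fun s hs => by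
      rw [hzero h3 s hs, zero_smul])
  filter_upwards [(ae_restrict_iff' measurableSet_Ioo).2 h] with s hs
  have h' : (v : L2 l) s - G s = C := sub_eq_zero.1 hs
  exact sub_eq_iff_eq_add.1 h'

theorem exists_continuous_rep {l : ℝ} (v : H1 l) :
    ∃ c : ℝ → R3, ContinuousOn c (Icc 0 l) ∧ (v : L2 l) =ᵐ[intervalMeasure l] c := by
  obtain ⟨C, hC⟩ := exists_eq_primitive v
  exact ⟨_, (continuous_const.add (continuous_primitive _)).continuousOn, hC⟩

/-- The continuous representative on `[0, l]` of `v ∈ H¹(0, l; ℝ³)`; the point values `v(0)` and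
`v(l)` are those of this function. -/
def rep {l : ℝ} (v : H1 l) : ℝ → R3 := (exists_continuous_rep v).choose

theorem rep_continuousOn {l : ℝ} (v : H1 l) : ContinuousOn (rep v) (Icc 0 l) :=
  (exists_continuous_rep v).choose_spec.1

theorem rep_ae_eq {l : ℝ} (v : H1 l) : (v : L2 l) =ᵐ[intervalMeasure l] rep v :=
  (exists_continuous_rep v).choose_spec.2

/-- The continuous representative is unique on `[0, l]`. -/
theorem rep_unique {l : ℝ} (hl : 0 < l) (v : H1 l) {c : ℝ → R3} (hc : ContinuousOn c (Icc 0 l))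
    (hv : (v : L2 l) =ᵐ[intervalMeasure l] c) : EqOn c (rep v) (Icc 0 l) := by
  have h1 : c =ᵐ[intervalMeasure l] rep v := hv.symm.trans (rep_ae_eq v)
  have h2 : EqOn c (rep v) (Ioo 0 l) :=
    Measure.eqOn_open_of_ae_eq h1 isOpen_Ioo (hc.mono Ioo_subset_Icc_self)
      ((rep_continuousOn v).mono Ioo_subset_Icc_self)
  exact h2.of_subset_closure hc (rep_continuousOn v) Ioo_subset_Icc_self
    (by rw [closure_Ioo hl.ne])

/-! ### The stent -/

/-- The cross product on `R3`. -/
def cross (x y : R3) : R3 := WithLp.toLp 2 (x.ofLp ⨯₃ y.ofLp)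

/-- The matrix-vector product on `R3`. -/
def mulVec3 (A : Matrix (Fin 3) (Fin 3) ℝ) (x : R3) : R3 := WithLp.toLp 2 (A *ᵥ x.ofLp)

/-- An elastic stent: a finite oriented graph with `nV` vertices and `nE` edges placed in `ℝ³`,
each edge being the middle curve of an elastic rod. -/
structure Stent (nV nE : ℕ) where
  /-- The points of `ℝ³` where the middle curves meet. -/
  vertex : Fin nV → R3
  /-- The vertex that the edge leaves. -/
  tail : Fin nE → Fin nV
  /-- The vertex that the edge enters. -/
  head : Fin nE → Fin nV
  /-- The lengths of the struts. -/
  len : Fin nE → ℝ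
  len_pos : ∀ i, 0 < len i
  /-- The natural parametrization of the middle curve, used on `[0, len i]` only. -/
  Φ : Fin nE → ℝ → R3
  Φ_zero : ∀ i, Φ i 0 = vertex (tail i)
  Φ_len : ∀ i, Φ i (len i) = vertex (head i)
  /-- The rotation matrix `[t, n, b]` associated with the middle curve. -/
  Q : Fin nE → ℝ → Matrix (Fin 3) (Fin 3) ℝ
  Q_mem : ∀ i, ∀ s ∈ Icc 0 (len i), Q i s ∈ Matrix.specialOrthogonalGroup (Fin 3) ℝ
  Q_measurable : ∀ i k m, AEMeasurable (fun s => Q i s k m) (intervalMeasure (len i))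
  /-- The first column `t` of `Q` is the derivative of `Φ`; it is a unit vector because `Q` is
  orthogonal. -/
  Φ_deriv : ∀ i, ∀ s ∈ Icc 0 (len i),
    HasDerivWithinAt (Φ i) (WithLp.toLp 2 fun k => Q i s k 0) (Icc 0 (len i)) s
  /-- Shear moduli. -/
  μ : Fin nE → ℝ
  /-- Young moduli. -/
  E : Fin nE → ℝ
  /-- `μ i * K i` is the torsional rigidity of the cross-section. -/
  K : Fin nE → ℝ
  /-- Moments of inertia of the cross-section. -/
  In : Fin nE → ℝ
  /-- Moments of inertia of the cross-section. -/
  Ib : Fin nE → ℝ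
  H_posDef : ∀ i, (Matrix.diagonal ![μ i * K i, E i * In i, E i * Ib i]).PosDef

namespace Stent

variable {nV nE : ℕ} (S : Stent nV nE)

/-- The unit tangent `t = Φ'`. -/
def tangent (i : Fin nE) (s : ℝ) : R3 := WithLp.toLp 2 fun k => S.Q i s k 0

/-- The matrix `H = diag(μ K, E I_n, E I_b)` of a strut. -/
def H (i : Fin nE) : Matrix (Fin 3) (Fin 3) ℝ :=
  Matrix.diagonal ![S.μ i * S.K i, S.E i * S.In i, S.E i * S.Ib i]

/-- The underlying undirected graph. -/
def graph : SimpleGraph (Fin nV) :=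
  SimpleGraph.fromRel fun x y => ∃ i, S.tail i = x ∧ S.head i = y

/-- The `i`-th edge is straight. -/
def IsStraight (i : Fin nE) : Prop :=
  ∃ τ : R3, ∀ s ∈ Icc 0 (S.len i), S.Φ i s = S.Φ i 0 + s • τ

open Classical in
/-- The restriction on the geometry: a family of axial forces in the straight struts that is in
equilibrium at every vertex vanishes. (The tangent of a straight strut is constant.) -/
def StraightCondition : Prop :=
  ∀ α : Fin nE → ℝ,
    (∀ j : Fin nV,
      ∑ i with S.head i = j ∧ S.IsStraight i, α i • S.tangent i 0
        - ∑ i with S.tail i = j ∧ S.IsStraight i, α i • S.tangent i 0 = 0) →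
    ∀ i, S.IsStraight i → α i = 0

/-- `A⁺ P` for the incidence matrix `A = A⁺ - A⁻`: the `3 × 3` block `(j, i)` of `A⁺` is the
identity if the edge `i` enters the vertex `j`, and zero otherwise. -/
def incPlus (P : Fin nE → R3) (j : Fin nV) : R3 := ∑ i with S.head i = j, P i

/-- `A⁻ P`: the `3 × 3` block `(j, i)` of `A⁻` is the identity if the edge `i` leaves the
vertex `j`, and zero otherwise. -/
def incMinus (P : Fin nE → R3) (j : Fin nV) : R3 := ∑ i with S.tail i = j, P i

/-- The space `V` of the tuples `(q, p, P₊, P₋, Q₊, Q₋, α, β)`. -/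
@[ext] structure V where
  q : ∀ i, L2 (S.len i)
  p : ∀ i, L2 (S.len i)
  Pp : Fin nE → R3
  Pm : Fin nE → R3
  Qp : Fin nE → R3
  Qm : Fin nE → R3
  α : R3
  β : R3

/-- The space `M` of the tuples `(u, ω, U, Ω)`, the components `ω` and `Ω` being called `w` and
`W` here. -/
@[ext] structure M where
  u : ∀ i, H1 (S.len i)
  w : ∀ i, H1 (S.len i)
  U : Fin nV → R3
  W : Fin nV → R3

/-- The integral over the whole graph. -/
def netIntegral (v : ∀ i, H1 (S.len i)) : R3 :=
  ∑ i, ∫ s, (v i : L2 (S.len i)) s ∂(intervalMeasure (S.len i))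

/-- The bilinear form `a`. -/
def a (σ γ : S.V) : ℝ :=
  ∑ i, ∫ s, inner ℝ (mulVec3 (S.Q i s * (S.H i)⁻¹ * (S.Q i s)ᵀ) (σ.q i s)) (γ.q i s)
    ∂(intervalMeasure (S.len i))

/-- The bilinear form `b`. -/
def b (σ : S.V) (ψ : S.M) : ℝ :=
  (∑ i, ∫ s, (- inner ℝ (σ.p i s)
        (weakDeriv (ψ.u i) s + cross (S.tangent i s) ((ψ.w i : L2 (S.len i)) s))
      - inner ℝ (σ.q i s) (weakDeriv (ψ.w i) s)) ∂(intervalMeasure (S.len i)))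
  + (∑ i, (inner ℝ (σ.Pp i) (rep (ψ.u i) (S.len i)) - inner ℝ (σ.Pm i) (rep (ψ.u i) 0)))
  + (∑ i, (inner ℝ (σ.Qp i) (rep (ψ.w i) (S.len i)) - inner ℝ (σ.Qm i) (rep (ψ.w i) 0)))
  - (∑ j, inner ℝ (S.incPlus σ.Pp j - S.incMinus σ.Pm j) (ψ.U j))
  - (∑ j, inner ℝ (S.incPlus σ.Qp j - S.incMinus σ.Qm j) (ψ.W j))
  + inner ℝ σ.α (S.netIntegral ψ.u) + inner ℝ σ.β (S.netIntegral ψ.w)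

/-- The linear functional given by the line density `f ∈ L²` of the applied forces. -/
def load (f : ∀ i, L2 (S.len i)) (ψ : S.M) : ℝ :=
  - (∑ i, ∫ s, inner ℝ (f i s) ((ψ.u i : L2 (S.len i)) s) ∂(intervalMeasure (S.len i)))

/-- `(σ, φ) ∈ V × M` solves the mixed variational stent problem with load density `f`. -/
def IsSolution (f : ∀ i, L2 (S.len i)) (σ : S.V) (φ : S.M) : Prop :=
  (∀ γ : S.V, S.a σ γ + S.b γ φ = 0) ∧ (∀ ψ : S.M, S.b σ ψ = S.load f ψ)

end Stent

end StentModel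

end

/-! The system turns out to be a linear boundary value problem for ordinary differential equations
on the edges, and it is solved by reduction to finite dimension instead of an inf-sup condition.

Varying $\psi$ in the second equation gives equilibrium in integrated form (`forall_b_eq_load_iff`):
$p' = -(\alpha+f)$, $q' = -(\beta+t\times p)$ on each edge, $P_\pm$, $Q_\pm$ are the end values of
$p$, $q$, and forces and couples balance at the vertices. Here $\alpha$, $\beta$ act as uniform
densities of force and couple. Varying $\Gamma$ in the first equation gives the kinematics
(`forall_a_add_b_iff`): $w' = QH^{-1}Q^Tq$, $u' = -t\times w$, continuity at the vertices, zero mean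
values.

Integrating for $p$, $q$, $w$, $u$ in this order shows that a solution is determined by
$x=(P_-,Q_-,U,W,\alpha,\beta)$. The conditions not yet used form a `residual` with exactly as many
scalar components as $x$, affine in $x$. Hence existence and uniqueness both follow once the linear
part is injective, that is, once $f=0$ forces $x=0$ (`param_eq_zero`).

For $f=0$, testing with the solution itself gives $a(\Sigma,\Sigma)=0$, so $q=0$ by positive
definiteness. Then $w$ is constant on edges, hence on the connected graph, and vanishes by its zero
mean; after that the same holds for $u$. On the static side (`statics_eq_zero`), total force balance
gives $\alpha=0$, total moment balance gives $\beta=0$, and $t\times P=0$ remains. A nonzero $P^i$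
is then an axial force in a straight edge (`isStraight_of_cross_eq_zero`), and the assumption on
straight edges excludes it. -/

noncomputable section

namespace StentModel

/-! ### Linear operators on `L²(0, l; ℝ³)` -/

/-- The constant functions in `L²(0, l; ℝ³)`. -/
def constL (l : ℝ) : R3 →ₗ[ℝ] L2 l := Lp.constₗ 2 (intervalMeasure l) ℝ

theorem coeFn_constL (l : ℝ) (c : R3) : constL l c =ᵐ[intervalMeasure l] fun _ => c :=
  Lp.coeFn_const 2 (intervalMeasure l) c

/-- The integral over `(0, l)`. -/
def integralL (l : ℝ) : L2 l →ₗ[ℝ] R3 where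
  toFun g := ∫ s, g s ∂(intervalMeasure l)
  map_add' g h := by
    rw [← integral_add (integrable_L2 g) (integrable_L2 h)]
    exact integral_congr_ae (Lp.coeFn_add g h)
  map_smul' c g := by
    rw [RingHom.id_apply, ← integral_smul]
    exact integral_congr_ae (Lp.coeFn_smul c g)

theorem integralL_apply {l : ℝ} (g : L2 l) :
    integralL l g = ∫ s, g s ∂(intervalMeasure l) := rfl

theorem integralL_constL {l : ℝ} (hl : 0 ≤ l) (c : R3) : integralL l (constL l c) = l • c := by
  rw [integralL_apply, integral_congr_ae (coeFn_constL l c)]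
  simp [hl, Measure.real]

/-- The primitive of `g` that vanishes at `0`. -/
def primitive {l : ℝ} (g : L2 l) (s : ℝ) : R3 := ∫ x, (Iio s).indicator g x ∂(intervalMeasure l)

theorem integrable_indicator_L2 {l : ℝ} (g : L2 l) (s : ℝ) :
    Integrable ((Iio s).indicator g) (intervalMeasure l) :=
  (integrable_L2 g).indicator measurableSet_Iio

theorem primitive_add {l : ℝ} (g h : L2 l) (s : ℝ) :
    primitive (g + h) s = primitive g s + primitive h s := by
  rw [primitive, primitive, primitive,
    ← integral_add (integrable_indicator_L2 g s) (integrable_indicator_L2 h s)]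
  refine integral_congr_ae ?_
  filter_upwards [Lp.coeFn_add g h] with x hx
  by_cases hs : x ∈ Iio s <;>
    simp only [indicator, hs, hx, if_true, if_false, Pi.add_apply, add_zero]

theorem primitive_smul {l : ℝ} (c : ℝ) (g : L2 l) (s : ℝ) :
    primitive (c • g) s = c • primitive g s := by
  rw [primitive, primitive, ← integral_smul]
  refine integral_congr_ae ?_
  filter_upwards [Lp.coeFn_smul c g] with x hx
  by_cases hs : x ∈ Iio s <;>
    simp only [indicator, hs, hx, if_true, if_false, Pi.smul_apply, smul_zero]

theorem primitive_zero_right {l : ℝ} (g : L2 l) : primitive g 0 = 0 := by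
  refine integral_eq_zero_of_ae ((ae_restrict_iff' measurableSet_Ioo).2
    (Filter.Eventually.of_forall fun x hx => ?_))
  exact indicator_of_notMem (s := Iio 0) (fun h : x < 0 => lt_asymm h hx.1) _

theorem primitive_length {l : ℝ} (g : L2 l) : primitive g l = integralL l g := by
  refine integral_congr_ae ((ae_restrict_iff' measurableSet_Ioo).2
    (Filter.Eventually.of_forall fun x hx => ?_))
  exact indicator_of_mem (s := Iio l) hx.2 _

theorem norm_primitive_le {l : ℝ} (g : L2 l) (s : ℝ) :
    ‖primitive g s‖ ≤ ∫ x, ‖g x‖ ∂(intervalMeasure l) :=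
  norm_integral_le_of_norm_le (integrable_L2 g).norm
    (Filter.Eventually.of_forall fun _ => norm_indicator_le_norm_self _ _)

theorem memLp_primitive {l : ℝ} (g : L2 l) : MemLp (primitive g) 2 (intervalMeasure l) :=
  MemLp.of_bound (continuous_primitive g).aestronglyMeasurable _
    (Filter.Eventually.of_forall (norm_primitive_le g))

/-- The primitive vanishing at `0`, as an operator on `L²(0, l; ℝ³)`. -/
def primitiveL (l : ℝ) : L2 l →ₗ[ℝ] L2 l where
  toFun g := (memLp_primitive g).toLp
  map_add' g h := by
    rw [← MemLp.toLp_add]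
    exact MemLp.toLp_congr _ _ (Filter.Eventually.of_forall (primitive_add g h))
  map_smul' c g := by
    rw [RingHom.id_apply, ← MemLp.toLp_const_smul]
    exact MemLp.toLp_congr _ _ (Filter.Eventually.of_forall (primitive_smul c g))

theorem coeFn_primitiveL {l : ℝ} (g : L2 l) :
    primitiveL l g =ᵐ[intervalMeasure l] primitive g := (memLp_primitive g).coeFn_toLp

theorem inner_constL {l : ℝ} (c : R3) (g : L2 l) :
    inner ℝ (constL l c) g = inner ℝ c (integralL l g) := by
  rw [L2.inner_def, integralL_apply, ← integral_inner (integrable_L2 g)]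
  refine integral_congr_ae ?_
  filter_upwards [coeFn_constL l c] with s hs
  rw [hs]

/-- Integration by parts for two primitives. -/
theorem inner_primitiveL_add {l : ℝ} (g h : L2 l) :
    inner ℝ g (primitiveL l h) + inner ℝ (primitiveL l g) h
      = inner ℝ (integralL l g) (integralL l h) := by
  set μ := intervalMeasure l
  have hprod : Integrable (fun z : ℝ × ℝ => (inner ℝ (g z.1) (h z.2) : ℝ)) (μ.prod μ) :=
    Integrable.op_fst_snd (op := fun x y : R3 => (inner ℝ x y : ℝ)) continuous_inner
      ⟨1, fun x y => by rw [one_mul]; exact norm_inner_le_norm x y⟩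
      (integrable_L2 g) (integrable_L2 h)
  -- Fubini: the right side is a double integral over the square, the two terms on the left are its
  -- parts on either side of the diagonal, and the diagonal is null.
  have hset : MeasurableSet {z : ℝ × ℝ | z.2 < z.1} := measurableSet_lt measurable_snd measurable_fst
  have hset' : MeasurableSet {z : ℝ × ℝ | z.1 < z.2} := measurableSet_lt measurable_fst measurable_snd
  have hi1 := hprod.indicator hset
  have hi2 := hprod.indicator hset'
  have e1 : inner ℝ g (primitiveL l h) = ∫ s, ∫ x, {z : ℝ × ℝ | z.2 < z.1}.indicator
      (fun z : ℝ × ℝ => (inner ℝ (g z.1) (h z.2) : ℝ)) (s, x) ∂μ ∂μ := by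
    rw [L2.inner_def]
    refine integral_congr_ae ?_
    filter_upwards [coeFn_primitiveL h] with s hs
    rw [hs, primitive, ← integral_inner (integrable_indicator_L2 h s)]
    congr 1 with x
    by_cases hx : x < s <;> simp [indicator, hx]
  have e2 : inner ℝ (primitiveL l g) h = ∫ s, ∫ x, {z : ℝ × ℝ | z.1 < z.2}.indicator
      (fun z : ℝ × ℝ => (inner ℝ (g z.1) (h z.2) : ℝ)) (s, x) ∂μ ∂μ := by
    rw [integral_integral_swap (f := fun s x => {z : ℝ × ℝ | z.1 < z.2}.indicator
      (fun z : ℝ × ℝ => (inner ℝ (g z.1) (h z.2) : ℝ)) (s, x)) hi2, L2.inner_def]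
    refine integral_congr_ae ?_
    filter_upwards [coeFn_primitiveL g] with x hx
    rw [hx, primitive, real_inner_comm, ← integral_inner (integrable_indicator_L2 g x)]
    congr 1 with s
    by_cases hs : s < x <;> simp [indicator, hs, real_inner_comm]
  have e3 : inner ℝ (integralL l g) (integralL l h)
      = ∫ s, ∫ x, (inner ℝ (g s) (h x) : ℝ) ∂μ ∂μ := by
    rw [real_inner_comm, integralL_apply g, ← integral_inner (integrable_L2 g)]
    congr 1 with s
    rw [real_inner_comm, integralL_apply h, ← integral_inner (integrable_L2 h)]
  rw [e1, e2, e3, ← integral_add hi1.integral_prod_left hi2.integral_prod_left]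
  refine integral_congr_ae ?_
  filter_upwards [hi1.prod_right_ae, hi2.prod_right_ae] with s h1 h2
  rw [← integral_add h1 h2]
  refine integral_congr_ae ?_
  filter_upwards [ae_restrict_of_ae (s := Ioo 0 l) (Measure.ae_ne volume s)] with x hx
  rcases lt_or_gt_of_ne hx with h' | h' <;> simp [indicator, h', h'.not_gt]

/-! ### Functions in `H¹(0, l; ℝ³)` as primitives -/

theorem isWeakDeriv_const_add_primitive {l : ℝ} (c : R3) (g : L2 l) :
    IsWeakDeriv l (constL l c + primitiveL l g) g := by
  intro φ h1 h2 h3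
  have hd : Continuous (deriv φ) := h1.continuous_deriv (by simp)
  have hc : ∫ s, deriv φ s • constL l c s ∂(intervalMeasure l) = 0 := by
    have : ∫ s, deriv φ s • constL l c s ∂(intervalMeasure l)
        = ∫ s, deriv φ s • c ∂(intervalMeasure l) := by
      refine integral_congr_ae ?_
      filter_upwards [coeFn_constL l c] with s hs
      rw [hs]
    rw [this, integral_smul_const]
    rcases le_or_gt l 0 with hl | hl
    · simp [Ioo_eq_empty (not_lt.2 hl)]
    rw [← integral_Ioc_eq_integral_Ioo, ← intervalIntegral.integral_of_le hl.le,
      intervalIntegral.integral_deriv_eq_sub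
        (fun s _ => (h1.differentiable (by simp)).differentiableAt) (hd.intervalIntegrable _ _),
      image_eq_zero_of_notMem_tsupport fun hh => (lt_irrefl l (h3 hh).2),
      image_eq_zero_of_notMem_tsupport fun hh => (lt_irrefl 0 (h3 hh).1), sub_self, zero_smul]
  rw [← integral_deriv_smul_primitive g h1 h2 h3]
  have hadd : ∫ s, deriv φ s • (constL l c + primitiveL l g : L2 l) s ∂(intervalMeasure l)
      = ∫ s, deriv φ s • constL l c s ∂(intervalMeasure l)
        + ∫ s, deriv φ s • primitiveL l g s ∂(intervalMeasure l) := by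
    rw [← integral_add (integrable_smul_L2 hd h2.deriv _) (integrable_smul_L2 hd h2.deriv _)]
    refine integral_congr_ae ?_
    filter_upwards [Lp.coeFn_add (constL l c) (primitiveL l g)] with s hs
    rw [hs, Pi.add_apply, smul_add]
  rw [hadd, hc, zero_add]
  refine integral_congr_ae ?_
  filter_upwards [coeFn_primitiveL g] with s hs
  rw [hs, primitive]

/-- The function in `H¹(0, l; ℝ³)` with initial value `c` and derivative `g`. -/
def ofDeriv {l : ℝ} (c : R3) (g : L2 l) : H1 l :=
  ⟨constL l c + primitiveL l g, g, isWeakDeriv_const_add_primitive c g⟩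

theorem coe_ofDeriv {l : ℝ} (c : R3) (g : L2 l) :
    (ofDeriv c g : L2 l) = constL l c + primitiveL l g := rfl

theorem weakDeriv_ofDeriv {l : ℝ} (c : R3) (g : L2 l) : weakDeriv (ofDeriv c g) = g :=
  (weakDeriv_spec _).unique (isWeakDeriv_const_add_primitive c g)

theorem rep_ofDeriv {l : ℝ} (hl : 0 < l) (c : R3) (g : L2 l) {s : ℝ} (hs : s ∈ Icc 0 l) :
    rep (ofDeriv c g) s = c + primitive g s := by
  refine (rep_unique hl (ofDeriv c g) (c := fun s => c + primitive g s)
    (continuous_const.add (continuous_primitive g)).continuousOn ?_ hs).symm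
  filter_upwards [Lp.coeFn_add (constL l c) (primitiveL l g), coeFn_constL l c,
    coeFn_primitiveL g] with x h1 h2 h3
  rw [coe_ofDeriv, h1, Pi.add_apply, h2, h3]

theorem rep_ofDeriv_zero {l : ℝ} (hl : 0 < l) (c : R3) (g : L2 l) :
    rep (ofDeriv c g) 0 = c := by
  rw [rep_ofDeriv hl c g ⟨le_rfl, hl.le⟩, primitive_zero_right, add_zero]

theorem rep_ofDeriv_length {l : ℝ} (hl : 0 < l) (c : R3) (g : L2 l) :
    rep (ofDeriv c g) l = c + integralL l g := by
  rw [rep_ofDeriv hl c g ⟨hl.le, le_rfl⟩, primitive_length]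

/-- Initial value and derivative are thus free, independent coordinates on `H1`; all variational
arguments below use them. -/
theorem eq_ofDeriv {l : ℝ} (hl : 0 < l) (v : H1 l) : v = ofDeriv (rep v 0) (weakDeriv v) := by
  obtain ⟨C, hC⟩ := exists_eq_primitive v
  have h : v = ofDeriv C (weakDeriv v) := by
    refine Subtype.ext (Lp.ext ?_)
    rw [coe_ofDeriv]
    filter_upwards [hC, Lp.coeFn_add (constL l C) (primitiveL l (weakDeriv v)), coeFn_constL l C,
      coeFn_primitiveL (weakDeriv v)] with x h0 h1 h2 h3
    rw [h0, h1, Pi.add_apply, h2, h3, primitive]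
  have h0 : rep v 0 = C := by
    conv_lhs => rw [h]
    exact rep_ofDeriv_zero hl _ _
  rw [h0]
  exact h

/-! ### Multiplication operators -/

theorem memLp_field_apply {l : ℝ} {B : ℝ → R3 →L[ℝ] R3} (hB : MemLp B ⊤ (intervalMeasure l))
    (g : L2 l) : MemLp (fun s => B s (g s)) 2 (intervalMeasure l) :=
  MemLp.of_bilin (fun (T : R3 →L[ℝ] R3) x => T x) 1 hB (Lp.memLp g)
    (isBoundedBilinearMap_apply.continuous.comp_aestronglyMeasurable
      (hB.aestronglyMeasurable.prodMk (Lp.memLp g).aestronglyMeasurable))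
    (Filter.Eventually.of_forall fun s => by
      rw [one_mul]; exact (B s).le_opNNNorm (g s))

/-- Multiplication with a bounded field of linear maps. -/
def fieldMul {l : ℝ} (B : ℝ → R3 →L[ℝ] R3) (hB : MemLp B ⊤ (intervalMeasure l)) :
    L2 l →ₗ[ℝ] L2 l where
  toFun g := (memLp_field_apply hB g).toLp
  map_add' g k := by
    rw [← MemLp.toLp_add]
    refine MemLp.toLp_congr _ _ ?_
    filter_upwards [Lp.coeFn_add g k] with s hs
    rw [hs, Pi.add_apply, Pi.add_apply, map_add]
  map_smul' c g := by
    rw [RingHom.id_apply, ← MemLp.toLp_const_smul]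
    refine MemLp.toLp_congr _ _ ?_
    filter_upwards [Lp.coeFn_smul c g] with s hs
    rw [hs, Pi.smul_apply, Pi.smul_apply, map_smul]

theorem coeFn_fieldMul {l : ℝ} {B : ℝ → R3 →L[ℝ] R3} (hB : MemLp B ⊤ (intervalMeasure l))
    (g : L2 l) : fieldMul B hB g =ᵐ[intervalMeasure l] fun s => B s (g s) :=
  (memLp_field_apply hB g).coeFn_toLp

/-! ### The cross product and the matrix-vector product -/

/-- The cross product as a bilinear map. -/
def crossL : R3 →ₗ[ℝ] R3 →L[ℝ] R3 :=
  LinearMap.toContinuousLinearMap.toLinearMap ∘ₗ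
    LinearMap.mk₂ ℝ cross
      (fun x y z => by simp [cross])
      (fun c x y => by simp [cross])
      (fun x y z => by simp [cross])
      (fun c x y => by simp [cross])

theorem crossL_apply (x y : R3) : crossL x y = cross x y := rfl

theorem inner_cross_right (x y z : R3) : (inner ℝ x (cross y z) : ℝ) = -inner ℝ (cross y x) z := by
  simp [cross, PiLp.inner_apply, Fin.sum_univ_three, cross_apply]
  ring

/-- Integration by parts: by `inner_primitiveL_add` the adjoint of the primitive from `0` is the
primitive from `l` up to sign. This removes `v` itself in favour of its two coordinates. -/
theorem inner_primitive_identity {l : ℝ} (hl : 0 < l) (F : L2 l) (v : H1 l) :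
    inner ℝ F (v : L2 l) = (inner ℝ (constL l (integralL l F) - primitiveL l F) (weakDeriv v)
      + inner ℝ (integralL l F) (rep v 0) : ℝ) := by
  conv_lhs => rw [eq_ofDeriv hl v, coe_ofDeriv]
  have h := inner_primitiveL_add F (weakDeriv v)
  rw [inner_add_right, real_inner_comm, inner_constL, inner_sub_left, inner_constL, ← h,
    real_inner_comm (integralL l F)]
  ring

theorem rep_length {l : ℝ} (hl : 0 < l) (v : H1 l) :
    rep v l = rep v 0 + integralL l (weakDeriv v) := by
  conv_lhs => rw [eq_ofDeriv hl v]
  exact rep_ofDeriv_length hl _ _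

/-- Reason: $y\times(x\times y)=\|y\|^2x-(x\cdot y)y$. The explicit coefficient can be
differentiated when `x` moves along a curve. -/
theorem eq_smul_of_cross_eq_zero {x y : R3} (hy : y ≠ 0) (h : cross x y = 0) :
    x = ((inner ℝ x y : ℝ) / ‖y‖ ^ 2) • y := by
  have hn : ‖y‖ ^ 2 ≠ 0 := pow_ne_zero 2 (norm_ne_zero_iff.2 hy)
  have h0 := congrArg (fun v : R3 => v 0) h
  have h1 := congrArg (fun v : R3 => v 1) h
  have h2 := congrArg (fun v : R3 => v 2) h
  simp [cross, cross_apply] at h0 h1 h2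
  have key : ‖y‖ ^ 2 • x = (inner ℝ x y : ℝ) • y := by
    ext k
    fin_cases k <;>
      simp [EuclideanSpace.norm_sq_eq, PiLp.inner_apply, Fin.sum_univ_three] <;>
      grind
  rw [div_eq_inv_mul, mul_smul, ← key, smul_smul, inv_mul_cancel₀ hn, one_smul]

theorem continuous_toEuclideanCLM :
    Continuous (Matrix.toEuclideanCLM (𝕜 := ℝ) (n := Fin 3)) :=
  (Matrix.toEuclideanCLM (𝕜 := ℝ) (n := Fin 3)).toAlgEquiv.toLinearMap.continuous_of_finiteDimensional

namespace Stent

variable {nV nE : ℕ} (S : Stent nV nE)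

/-! ### The coefficient operators of a strut -/

theorem ae_mem_Icc (i : Fin nE) : ∀ᵐ s ∂(intervalMeasure (S.len i)), s ∈ Icc 0 (S.len i) :=
  (ae_restrict_iff' measurableSet_Ioo).2
    (Filter.Eventually.of_forall fun _ hs => Ioo_subset_Icc_self hs)

theorem mul_transpose_Q {i : Fin nE} {s : ℝ} (hs : s ∈ Icc 0 (S.len i)) :
    S.Q i s * (S.Q i s)ᵀ = 1 :=
  Matrix.mem_orthogonalGroup_iff (Fin 3) ℝ |>.1
    (Matrix.mem_specialOrthogonalGroup_iff.1 (S.Q_mem i s hs)).1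

theorem transpose_mul_Q {i : Fin nE} {s : ℝ} (hs : s ∈ Icc 0 (S.len i)) :
    (S.Q i s)ᵀ * S.Q i s = 1 :=
  mul_eq_one_comm.1 (S.mul_transpose_Q hs)

/-- Entries of an orthogonal matrix lie in $[-1,1]$, so `F` is only evaluated on a compact set. -/
theorem memLp_comp_Q (i : Fin nE) {F : Matrix (Fin 3) (Fin 3) ℝ → R3 →L[ℝ] R3}
    (hF : Continuous F) : MemLp (fun s => F (S.Q i s)) ⊤ (intervalMeasure (S.len i)) := by
  have hm : AEStronglyMeasurable (fun s => (S.Q i s : Fin 3 → Fin 3 → ℝ))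
      (intervalMeasure (S.len i)) :=
    (aemeasurable_pi_iff.2 fun k => aemeasurable_pi_iff.2 (S.Q_measurable i k)).aestronglyMeasurable
  have hK : IsCompact {A : Matrix (Fin 3) (Fin 3) ℝ | ∀ k m, A k m ∈ Icc (-1 : ℝ) 1} := by
    have h := isCompact_univ_pi fun _ : Fin 3 => isCompact_univ_pi fun _ : Fin 3 =>
      isCompact_Icc (a := (-1 : ℝ)) (b := 1)
    have e : (univ.pi fun _ : Fin 3 => univ.pi fun _ : Fin 3 => Icc (-1 : ℝ) 1)
        = {A : Fin 3 → Fin 3 → ℝ | ∀ k m, A k m ∈ Icc (-1 : ℝ) 1} := by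
      ext A
      simp only [mem_ofPred_eq, mem_univ_pi]
    rw [e] at h
    exact h
  obtain ⟨C, hC⟩ := hK.exists_bound_of_continuousOn hF.continuousOn
  refine memLp_top_of_bound (hF.comp_aestronglyMeasurable hm) C ?_
  filter_upwards [S.ae_mem_Icc i] with s hs
  refine hC _ fun k m => abs_le.1 ?_
  exact entry_norm_bound_of_unitary (Matrix.mem_specialOrthogonalGroup_iff.1 (S.Q_mem i s hs)).1 k m

/-- The field of maps `x ↦ t × x` is bounded. -/
theorem memLp_crossL_tangent (i : Fin nE) :
    MemLp (fun s => crossL (S.tangent i s)) ⊤ (intervalMeasure (S.len i)) := by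
  refine S.memLp_comp_Q i (F := fun A => crossL (WithLp.toLp 2 fun k => A k 0)) ?_
  refine crossL.continuous_of_finiteDimensional.comp ?_
  refine (PiLp.continuous_toLp 2 _).comp (continuous_pi fun k => ?_)
  exact continuous_id.matrix_elem k 0

/-- The field of compliance matrices `Q H⁻¹ Qᵀ` is bounded. -/
theorem memLp_compliance (i : Fin nE) :
    MemLp (fun s => Matrix.toEuclideanCLM (𝕜 := ℝ) (S.Q i s * (S.H i)⁻¹ * (S.Q i s)ᵀ)) ⊤
      (intervalMeasure (S.len i)) := by
  refine S.memLp_comp_Q i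
    (F := fun A => Matrix.toEuclideanCLM (𝕜 := ℝ) (A * (S.H i)⁻¹ * Aᵀ)) ?_
  refine continuous_toEuclideanCLM.comp ?_
  fun_prop

/-- The operator `x ↦ t × x` on `L²`. -/
def crossT (i : Fin nE) : L2 (S.len i) →ₗ[ℝ] L2 (S.len i) :=
  fieldMul _ (S.memLp_crossL_tangent i)

/-- The operator `x ↦ Q H⁻¹ Qᵀ x` on `L²`. -/
def compliance (i : Fin nE) : L2 (S.len i) →ₗ[ℝ] L2 (S.len i) :=
  fieldMul _ (S.memLp_compliance i)

theorem coeFn_crossT {i : Fin nE} (g : L2 (S.len i)) :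
    S.crossT i g =ᵐ[intervalMeasure (S.len i)] fun s => cross (S.tangent i s) (g s) :=
  coeFn_fieldMul _ g

theorem coeFn_compliance {i : Fin nE} (g : L2 (S.len i)) :
    S.compliance i g =ᵐ[intervalMeasure (S.len i)]
      fun s => mulVec3 (S.Q i s * (S.H i)⁻¹ * (S.Q i s)ᵀ) (g s) :=
  coeFn_fieldMul _ g

theorem inner_crossT {i : Fin nE} (g h : L2 (S.len i)) :
    (inner ℝ g (S.crossT i h) : ℝ) = -inner ℝ (S.crossT i g) h := by
  rw [L2.inner_def, L2.inner_def, ← integral_neg]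
  refine integral_congr_ae ?_
  filter_upwards [S.coeFn_crossT g, S.coeFn_crossT h] with s h1 h2
  rw [h1, h2, inner_cross_right]

theorem posDef_compliance {i : Fin nE} {s : ℝ} (hs : s ∈ Icc 0 (S.len i)) :
    (S.Q i s * (S.H i)⁻¹ * (S.Q i s)ᵀ).PosDef := by
  have h : ((S.H i)⁻¹).PosDef := Matrix.PosDef.inv (S.H_posDef i)
  rw [← Matrix.conjTranspose_eq_transpose_of_trivial]
  refine h.mul_mul_conjTranspose_same fun v w hvw => ?_
  have h2 := congrArg (fun u => Matrix.vecMul u (S.Q i s)ᵀ) hvw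
  simpa only [Matrix.vecMul_vecMul, S.mul_transpose_Q hs, Matrix.vecMul_one] using h2

theorem inner_mulVec3_self (A : Matrix (Fin 3) (Fin 3) ℝ) (x : R3) :
    (inner ℝ (mulVec3 A x) x : ℝ) = x.ofLp ⬝ᵥ (A *ᵥ x.ofLp) := by
  simp [mulVec3, PiLp.inner_apply, dotProduct]

/-- The integrand is nonnegative and vanishes only where `g` does. Pointwise definiteness suffices;
no uniform coercivity constant is needed. -/
theorem eq_zero_of_inner_compliance {i : Fin nE} (g : L2 (S.len i))
    (h : (inner ℝ (S.compliance i g) g : ℝ) ≤ 0) : g = 0 := by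
  have hpos : ∀ᵐ s ∂(intervalMeasure (S.len i)), ∀ x : R3,
      0 ≤ (inner ℝ (mulVec3 (S.Q i s * (S.H i)⁻¹ * (S.Q i s)ᵀ) x) x : ℝ) ∧
      ((inner ℝ (mulVec3 (S.Q i s * (S.H i)⁻¹ * (S.Q i s)ᵀ) x) x : ℝ) = 0 → x = 0) := by
    filter_upwards [S.ae_mem_Icc i] with s hs x
    rw [inner_mulVec3_self]
    have hA := S.posDef_compliance hs
    refine ⟨by simpa using hA.posSemidef.dotProduct_mulVec_nonneg x.ofLp, fun h0 => ?_⟩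
    by_contra hx
    have := hA.dotProduct_mulVec_pos (x := x.ofLp) (by simpa using hx)
    simp only [star_trivial] at this
    exact this.ne' h0
  have hnn : 0 ≤ᵐ[intervalMeasure (S.len i)]
      fun s => (inner ℝ (S.compliance i g s) (g s) : ℝ) := by
    filter_upwards [hpos, S.coeFn_compliance g] with s h1 h2
    rw [h2]
    exact (h1 _).1
  rw [L2.inner_def] at h
  have h0 := (integral_eq_zero_iff_of_nonneg_ae hnn (L2.integrable_inner _ _)).1
    (le_antisymm h (integral_nonneg_of_ae hnn))
  refine Lp.ext ?_
  filter_upwards [hpos, S.coeFn_compliance g, h0, Lp.coeFn_zero R3 2 (intervalMeasure (S.len i))]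
    with s h1 h2 h3 h4
  rw [h4]
  refine (h1 (g s)).2 ?_
  rw [← h2]
  exact h3

/-! ### The bilinear forms in terms of operators -/

theorem a_eq (σ γ : S.V) : S.a σ γ = ∑ i, inner ℝ (S.compliance i (σ.q i)) (γ.q i) := by
  refine Finset.sum_congr rfl fun i _ => ?_
  rw [L2.inner_def]
  refine integral_congr_ae ?_
  filter_upwards [S.coeFn_compliance (σ.q i)] with s hs
  rw [hs]

theorem load_eq (f : ∀ i, L2 (S.len i)) (ψ : S.M) :
    S.load f ψ = -∑ i, inner ℝ (f i) (ψ.u i : L2 (S.len i)) := rfl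

theorem netIntegral_eq (v : ∀ i, H1 (S.len i)) :
    S.netIntegral v = ∑ i, integralL (S.len i) (v i) := rfl

theorem strut_integral_eq (i : Fin nE) (p q : L2 (S.len i)) (u w : H1 (S.len i)) :
    ∫ s, (- inner ℝ (p s) (weakDeriv u s + cross (S.tangent i s) ((w : L2 (S.len i)) s))
      - inner ℝ (q s) (weakDeriv w s)) ∂(intervalMeasure (S.len i))
      = (-inner ℝ p (weakDeriv u + S.crossT i w) - inner ℝ q (weakDeriv w) : ℝ) := by
  rw [L2.inner_def, L2.inner_def, ← integral_neg]
  refine Eq.trans (integral_congr_ae ?_)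
    (integral_sub (L2.integrable_inner p (weakDeriv u + S.crossT i w)).neg
      (L2.integrable_inner q (weakDeriv w)))
  filter_upwards [S.coeFn_crossT (w : L2 (S.len i)),
    Lp.coeFn_add (weakDeriv u) (S.crossT i w)] with s h1 h2
  rw [h2, Pi.add_apply, h1]

theorem sum_inner_incPlus (P : Fin nE → R3) (U : Fin nV → R3) :
    ∑ j, (inner ℝ (S.incPlus P j) (U j) : ℝ) = ∑ i, inner ℝ (P i) (U (S.head i)) := by
  rw [← Finset.sum_fiberwise _ S.head]
  refine Finset.sum_congr rfl fun j _ => ?_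
  rw [incPlus, sum_inner]
  refine Finset.sum_congr rfl fun i hi => ?_
  rw [(Finset.mem_filter.1 hi).2]

theorem sum_inner_incMinus (P : Fin nE → R3) (U : Fin nV → R3) :
    ∑ j, (inner ℝ (S.incMinus P j) (U j) : ℝ) = ∑ i, inner ℝ (P i) (U (S.tail i)) := by
  rw [← Finset.sum_fiberwise _ S.tail]
  refine Finset.sum_congr rfl fun j _ => ?_
  rw [incMinus, sum_inner]
  refine Finset.sum_congr rfl fun i hi => ?_
  rw [(Finset.mem_filter.1 hi).2]

/-- Sorted by stress components: each one is paired with a single kinematic defect. -/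
theorem b_eq (σ : S.V) (ψ : S.M) : S.b σ ψ =
    (∑ i, (-inner ℝ (σ.p i) (weakDeriv (ψ.u i) + S.crossT i (ψ.w i))
      - inner ℝ (σ.q i) (weakDeriv (ψ.w i))
      + inner ℝ (σ.Pp i) (rep (ψ.u i) (S.len i) - ψ.U (S.head i))
      - inner ℝ (σ.Pm i) (rep (ψ.u i) 0 - ψ.U (S.tail i))
      + inner ℝ (σ.Qp i) (rep (ψ.w i) (S.len i) - ψ.W (S.head i))
      - inner ℝ (σ.Qm i) (rep (ψ.w i) 0 - ψ.W (S.tail i))))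
    + inner ℝ σ.α (∑ i, integralL (S.len i) (ψ.u i))
    + inner ℝ σ.β (∑ i, integralL (S.len i) (ψ.w i)) := by
  simp only [b, strut_integral_eq, netIntegral_eq, inner_sub_left, inner_sub_right,
    Finset.sum_sub_distrib, Finset.sum_add_distrib, sum_inner_incPlus, sum_inner_incMinus]
  ring

/-- Sorted by the independent coordinates of `ψ`, after integration by parts: each coefficient is
the defect of one equilibrium equation. -/
theorem b_sub_load_eq (f : ∀ i, L2 (S.len i)) (σ : S.V) (ψ : S.M) : S.b σ ψ - S.load f ψ =
    (∑ i, (inner ℝ (constL _ (σ.Pp i + integralL _ (constL _ σ.α + f i))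
          - primitiveL _ (constL _ σ.α + f i) - σ.p i) (weakDeriv (ψ.u i))
      + inner ℝ (σ.Pp i - σ.Pm i + integralL _ (constL _ σ.α + f i)) (rep (ψ.u i) 0)
      + inner ℝ (constL _ (σ.Qp i + integralL _ (constL _ σ.β + S.crossT i (σ.p i)))
          - primitiveL _ (constL _ σ.β + S.crossT i (σ.p i)) - σ.q i) (weakDeriv (ψ.w i))
      + inner ℝ (σ.Qp i - σ.Qm i + integralL _ (constL _ σ.β + S.crossT i (σ.p i)))
          (rep (ψ.w i) 0)))
    - (∑ j, inner ℝ (S.incPlus σ.Pp j - S.incMinus σ.Pm j) (ψ.U j))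
    - (∑ j, inner ℝ (S.incPlus σ.Qp j - S.incMinus σ.Qm j) (ψ.W j)) := by
  have h1 := fun i => inner_primitive_identity (S.len_pos i) (constL _ σ.α + f i) (ψ.u i)
  have h2 := fun i => inner_primitive_identity (S.len_pos i)
    (constL _ σ.β + S.crossT i (σ.p i)) (ψ.w i)
  have h3 := fun i => S.inner_crossT (σ.p i) (ψ.w i)
  have key : ∀ i, (inner ℝ (constL _ (σ.Pp i + integralL _ (constL _ σ.α + f i))
          - primitiveL _ (constL _ σ.α + f i) - σ.p i) (weakDeriv (ψ.u i))
      + inner ℝ (σ.Pp i - σ.Pm i + integralL _ (constL _ σ.α + f i)) (rep (ψ.u i) 0)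
      + inner ℝ (constL _ (σ.Qp i + integralL _ (constL _ σ.β + S.crossT i (σ.p i)))
          - primitiveL _ (constL _ σ.β + S.crossT i (σ.p i)) - σ.q i) (weakDeriv (ψ.w i))
      + inner ℝ (σ.Qp i - σ.Qm i + integralL _ (constL _ σ.β + S.crossT i (σ.p i)))
          (rep (ψ.w i) 0) : ℝ)
      = (-inner ℝ (σ.p i) (weakDeriv (ψ.u i) + S.crossT i (ψ.w i))
        - inner ℝ (σ.q i) (weakDeriv (ψ.w i)))
      + (inner ℝ (σ.Pp i) (rep (ψ.u i) (S.len i)) - inner ℝ (σ.Pm i) (rep (ψ.u i) 0))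
      + (inner ℝ (σ.Qp i) (rep (ψ.w i) (S.len i)) - inner ℝ (σ.Qm i) (rep (ψ.w i) 0))
      + inner ℝ σ.α (integralL (S.len i) (ψ.u i)) + inner ℝ σ.β (integralL (S.len i) (ψ.w i))
      + inner ℝ (f i) (ψ.u i : L2 (S.len i)) := by
    intro i
    have e1 := h1 i
    have e2 := h2 i
    have e3 := h3 i
    rw [rep_length (S.len_pos i) (ψ.u i), rep_length (S.len_pos i) (ψ.w i)]
    simp only [inner_add_left, inner_add_right, inner_sub_left, inner_constL] at e1 e2 ⊢
    linarith
  rw [Finset.sum_congr rfl fun i _ => key i]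
  simp only [b, strut_integral_eq, netIntegral_eq, load_eq, Finset.sum_add_distrib,
    inner_sum, sub_neg_eq_add]
  ring

/-! ### The strong form of the equations -/

theorem eq_zero_of_norm_sq_le {F : Type*} [NormedAddCommGroup F] {x : F} (hx : ‖x‖ ^ 2 ≤ 0) :
    x = 0 :=
  norm_eq_zero.1 (pow_eq_zero_iff two_ne_zero |>.1 (le_antisymm hx (sq_nonneg _)))

theorem eq_zero_of_sum_add_eq_zero {ι : Type*} [Fintype ι] {r : ι → ℝ} {x : ℝ}
    (hr : ∀ i, 0 ≤ r i) (hx : 0 ≤ x) (h : ∑ i, r i + x = 0) : (∀ i, r i = 0) ∧ x = 0 := by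
  have h1 : 0 ≤ ∑ i, r i := Finset.sum_nonneg fun i _ => hr i
  have h2 : ∑ i, r i = 0 := by linarith
  exact ⟨fun i => (Finset.sum_eq_zero_iff_of_nonneg fun i _ => hr i).1 h2 i (Finset.mem_univ i),
    by linarith⟩

theorem forall_a_add_b_iff (σ : S.V) (φ : S.M) : (∀ γ : S.V, S.a σ γ + S.b γ φ = 0) ↔
    (∀ i, weakDeriv (φ.w i) = S.compliance i (σ.q i) ∧
      weakDeriv (φ.u i) = -S.crossT i (φ.w i) ∧
      rep (φ.u i) (S.len i) = φ.U (S.head i) ∧ rep (φ.u i) 0 = φ.U (S.tail i) ∧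
      rep (φ.w i) (S.len i) = φ.W (S.head i) ∧ rep (φ.w i) 0 = φ.W (S.tail i)) ∧
    ∑ i, integralL (S.len i) (φ.u i) = 0 ∧ ∑ i, integralL (S.len i) (φ.w i) = 0 := by
  constructor
  · intro h
    -- The test element consists of the defects themselves, with the signs of `b`, so the equation
    -- becomes a vanishing sum of squares.
    have h1 := h ⟨fun i => S.compliance i (σ.q i) - weakDeriv (φ.w i),
      fun i => -(weakDeriv (φ.u i) + S.crossT i (φ.w i)),
      fun i => rep (φ.u i) (S.len i) - φ.U (S.head i),
      fun i => -(rep (φ.u i) 0 - φ.U (S.tail i)),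
      fun i => rep (φ.w i) (S.len i) - φ.W (S.head i),
      fun i => -(rep (φ.w i) 0 - φ.W (S.tail i)),
      ∑ i, integralL (S.len i) (φ.u i), ∑ i, integralL (S.len i) (φ.w i)⟩
    rw [a_eq, b_eq] at h1
    simp only [inner_neg_left, neg_neg, sub_neg_eq_add] at h1
    rw [← add_assoc, ← add_assoc, ← Finset.sum_add_distrib, add_assoc] at h1
    obtain ⟨h2, h3⟩ := eq_zero_of_sum_add_eq_zero
      (r := fun i => ‖S.compliance i (σ.q i) - weakDeriv (φ.w i)‖ ^ 2
        + ‖weakDeriv (φ.u i) + S.crossT i (φ.w i)‖ ^ 2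
        + ‖rep (φ.u i) (S.len i) - φ.U (S.head i)‖ ^ 2 + ‖rep (φ.u i) 0 - φ.U (S.tail i)‖ ^ 2
        + ‖rep (φ.w i) (S.len i) - φ.W (S.head i)‖ ^ 2 + ‖rep (φ.w i) 0 - φ.W (S.tail i)‖ ^ 2)
      (x := ‖∑ i, integralL (S.len i) (φ.u i)‖ ^ 2 + ‖∑ i, integralL (S.len i) (φ.w i)‖ ^ 2)
      (fun i => by positivity) (by positivity) (by
        refine Eq.trans ?_ h1
        congr 1
        · refine Finset.sum_congr rfl fun i _ => ?_
          have e1 := inner_sub_left (𝕜 := ℝ) (S.compliance i (σ.q i)) (weakDeriv (φ.w i))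
            (S.compliance i (σ.q i) - weakDeriv (φ.w i))
          have e2 := real_inner_comm (weakDeriv (φ.w i))
            (S.compliance i (σ.q i) - weakDeriv (φ.w i))
          simp only [← real_inner_self_eq_norm_sq]
          linarith
        · simp only [← real_inner_self_eq_norm_sq])
    refine ⟨fun i => ?_, eq_zero_of_norm_sq_le ?_, eq_zero_of_norm_sq_le ?_⟩
    · have hi := h2 i
      have k1 := sq_nonneg ‖S.compliance i (σ.q i) - weakDeriv (φ.w i)‖
      have k2 := sq_nonneg ‖weakDeriv (φ.u i) + S.crossT i (φ.w i)‖
      have k3 := sq_nonneg ‖rep (φ.u i) (S.len i) - φ.U (S.head i)‖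
      have k4 := sq_nonneg ‖rep (φ.u i) 0 - φ.U (S.tail i)‖
      have k5 := sq_nonneg ‖rep (φ.w i) (S.len i) - φ.W (S.head i)‖
      have k6 := sq_nonneg ‖rep (φ.w i) 0 - φ.W (S.tail i)‖
      exact ⟨(sub_eq_zero.1 (eq_zero_of_norm_sq_le (by linarith))).symm,
        eq_neg_of_add_eq_zero_left (eq_zero_of_norm_sq_le (by linarith)),
        sub_eq_zero.1 (eq_zero_of_norm_sq_le (by linarith)),
        sub_eq_zero.1 (eq_zero_of_norm_sq_le (by linarith)),
        sub_eq_zero.1 (eq_zero_of_norm_sq_le (by linarith)),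
        sub_eq_zero.1 (eq_zero_of_norm_sq_le (by linarith))⟩
    · linarith [sq_nonneg ‖∑ i, integralL (S.len i) (φ.w i)‖]
    · linarith [sq_nonneg ‖∑ i, integralL (S.len i) (φ.u i)‖]
  · rintro ⟨h, hu, hw⟩ γ
    rw [a_eq, b_eq, hu, hw, inner_zero_right, inner_zero_right, add_zero, add_zero,
      ← Finset.sum_add_distrib]
    refine Finset.sum_eq_zero fun i _ => ?_
    obtain ⟨e1, e2, e3, e4, e5, e6⟩ := h i
    rw [e1, e2, e3, e4, e5, e6, neg_add_cancel, sub_self, sub_self, sub_self, sub_self,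
      real_inner_comm]
    simp

theorem forall_b_eq_load_iff (f : ∀ i, L2 (S.len i)) (σ : S.V) :
    (∀ ψ : S.M, S.b σ ψ = S.load f ψ) ↔
    (∀ i, σ.p i = constL _ (σ.Pm i) - primitiveL _ (constL _ σ.α + f i) ∧
      σ.Pp i = σ.Pm i - integralL _ (constL _ σ.α + f i) ∧
      σ.q i = constL _ (σ.Qm i) - primitiveL _ (constL _ σ.β + S.crossT i (σ.p i)) ∧
      σ.Qp i = σ.Qm i - integralL _ (constL _ σ.β + S.crossT i (σ.p i))) ∧
    (∀ j, S.incPlus σ.Pp j = S.incMinus σ.Pm j) ∧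
    (∀ j, S.incPlus σ.Qp j = S.incMinus σ.Qm j) := by
  constructor
  · intro h
    set r1 : ∀ i, L2 (S.len i) := fun i =>
      constL _ (σ.Pp i + integralL _ (constL _ σ.α + f i))
          - primitiveL _ (constL _ σ.α + f i) - σ.p i with hr1
    set r2 : Fin nE → R3 := fun i =>
      σ.Pp i - σ.Pm i + integralL _ (constL _ σ.α + f i) with hr2
    set r3 : ∀ i, L2 (S.len i) := fun i =>
      constL _ (σ.Qp i + integralL _ (constL _ σ.β + S.crossT i (σ.p i)))
          - primitiveL _ (constL _ σ.β + S.crossT i (σ.p i)) - σ.q i with hr3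
    set r4 : Fin nE → R3 := fun i =>
      σ.Qp i - σ.Qm i + integralL _ (constL _ σ.β + S.crossT i (σ.p i)) with hr4
    set r5 : Fin nV → R3 := fun j => S.incPlus σ.Pp j - S.incMinus σ.Pm j with hr5
    set r6 : Fin nV → R3 := fun j => S.incPlus σ.Qp j - S.incMinus σ.Qm j with hr6
    -- Again the defects are the test element: as derivatives, initial values and, with reversed
    -- sign, vertex values.
    have h1 := sub_eq_zero.2 (h ⟨fun i => ofDeriv (r2 i) (r1 i), fun i => ofDeriv (r4 i) (r3 i),
      fun j => -r5 j, fun j => -r6 j⟩)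
    rw [b_sub_load_eq] at h1
    -- The trailing zero allows a second use of `eq_zero_of_sum_add_eq_zero`, for the vertex sum.
    have h2 : ∑ i, (‖r1 i‖ ^ 2 + ‖r2 i‖ ^ 2 + ‖r3 i‖ ^ 2 + ‖r4 i‖ ^ 2)
        + (∑ j, (‖r5 j‖ ^ 2 + ‖r6 j‖ ^ 2) + 0) = 0 := by
      refine Eq.trans ?_ h1
      rw [add_zero, Finset.sum_add_distrib (f := fun j => ‖r5 j‖ ^ 2), ← add_assoc]
      simp only [weakDeriv_ofDeriv, rep_ofDeriv_zero (S.len_pos _), inner_neg_right,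
        Finset.sum_neg_distrib, sub_neg_eq_add, ← real_inner_self_eq_norm_sq]
      rfl
    obtain ⟨h3, h4⟩ := eq_zero_of_sum_add_eq_zero (fun i => by positivity)
      (by positivity) h2
    obtain ⟨h5, -⟩ := eq_zero_of_sum_add_eq_zero (fun i => by positivity) le_rfl h4
    refine ⟨fun i => ?_, fun j => ?_, fun j => ?_⟩
    · have hi := h3 i
      have k1 := sq_nonneg ‖r1 i‖
      have k2 := sq_nonneg ‖r2 i‖
      have k3 := sq_nonneg ‖r3 i‖
      have k4 := sq_nonneg ‖r4 i‖
      have z1 : r1 i = 0 := eq_zero_of_norm_sq_le (by linarith)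
      have z2 : r2 i = 0 := eq_zero_of_norm_sq_le (by linarith)
      have z3 : r3 i = 0 := eq_zero_of_norm_sq_le (by linarith)
      have z4 : r4 i = 0 := eq_zero_of_norm_sq_le (by linarith)
      simp only [hr1, hr2, hr3, hr4] at z1 z2 z3 z4
      have y2 : σ.Pp i = σ.Pm i - integralL _ (constL _ σ.α + f i) := by
        rw [← sub_eq_zero, ← z2]; abel
      have y4 : σ.Qp i = σ.Qm i - integralL _ (constL _ σ.β + S.crossT i (σ.p i)) := by
        rw [← sub_eq_zero, ← z4]; abel
      refine ⟨?_, y2, ?_, y4⟩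
      · rw [y2, sub_add_cancel] at z1
        exact (sub_eq_zero.1 z1).symm
      · rw [y4, sub_add_cancel] at z3
        exact (sub_eq_zero.1 z3).symm
    · have hj := h5 j
      exact sub_eq_zero.1 (eq_zero_of_norm_sq_le (x := r5 j) (by linarith [sq_nonneg ‖r6 j‖]))
    · have hj := h5 j
      exact sub_eq_zero.1 (eq_zero_of_norm_sq_le (x := r6 j) (by linarith [sq_nonneg ‖r5 j‖]))
  · rintro ⟨h, hP, hQ⟩ ψ
    rw [← sub_eq_zero, b_sub_load_eq]
    simp only [hP, hQ, sub_self, inner_zero_left, Finset.sum_const_zero, sub_zero]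
    refine Finset.sum_eq_zero fun i _ => ?_
    obtain ⟨e1, e2, e3, e4⟩ := h i
    rw [e2, e4, sub_add_cancel, sub_add_cancel, ← e1, ← e3]
    simp

end Stent

theorem constL_add_primitiveL_eq_zero {l : ℝ} (hl : 0 < l) {c : R3} {g : L2 l}
    (h : constL l c + primitiveL l g = 0) : c = 0 ∧ g = 0 := by
  have h0 : ofDeriv c g = ofDeriv 0 0 := Subtype.ext (by simp [coe_ofDeriv, h])
  constructor
  · rw [← rep_ofDeriv_zero hl c g, h0, rep_ofDeriv_zero hl]
  · rw [← weakDeriv_ofDeriv c g, h0, weakDeriv_ofDeriv]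

namespace Stent

variable {nV nE : ℕ} (S : Stent nV nE)

theorem inner_compliance_nonneg {i : Fin nE} (g : L2 (S.len i)) :
    0 ≤ (inner ℝ (S.compliance i g) g : ℝ) := by
  by_contra h
  rw [S.eq_zero_of_inner_compliance g (not_le.1 h).le, inner_zero_right] at h
  exact h le_rfl

/-! ### The geometry of the graph -/

theorem eq_of_connected (hconn : S.graph.Connected) {U : Fin nV → R3}
    (h : ∀ i, U (S.tail i) = U (S.head i)) (j k : Fin nV) : U j = U k := by
  obtain ⟨p⟩ := hconn.preconnected j k
  induction p with
  | nil => rfl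
  | cons hadj _ ih =>
    rw [← ih]
    rcases ((SimpleGraph.fromRel_adj _ _ _).1 hadj).2 with ⟨i, rfl, rfl⟩ | ⟨i, rfl, rfl⟩
    · exact h i
    · exact (h i).symm

theorem eq_zero_of_sum_len_smul (hE : 0 < nE) {c : R3} (h : ∑ i, S.len i • c = 0) : c = 0 := by
  rw [← Finset.sum_smul] at h
  have : 0 < ∑ i, S.len i :=
    Finset.sum_pos (fun i _ => S.len_pos i) ⟨⟨0, hE⟩, Finset.mem_univ _⟩
  exact (smul_eq_zero.1 h).resolve_left this.ne'

theorem sum_incPlus (P : Fin nE → R3) : ∑ j, S.incPlus P j = ∑ i, P i :=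
  Finset.sum_fiberwise _ S.head P

theorem sum_incMinus (P : Fin nE → R3) : ∑ j, S.incMinus P j = ∑ i, P i :=
  Finset.sum_fiberwise _ S.tail P

/-- Moments about the origin: together with `sum_cross_incMinus` this turns force balance at the
vertices into a total moment balance. -/
theorem sum_cross_incPlus (P : Fin nE → R3) :
    ∑ j, crossL (S.vertex j) (S.incPlus P j) = ∑ i, crossL (S.vertex (S.head i)) (P i) := by
  rw [← Finset.sum_fiberwise _ S.head]
  refine Finset.sum_congr rfl fun j _ => ?_
  rw [incPlus, map_sum]
  refine Finset.sum_congr rfl fun i hi => ?_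
  rw [(Finset.mem_filter.1 hi).2]

theorem sum_cross_incMinus (P : Fin nE → R3) :
    ∑ j, crossL (S.vertex j) (S.incMinus P j) = ∑ i, crossL (S.vertex (S.tail i)) (P i) := by
  rw [← Finset.sum_fiberwise _ S.tail]
  refine Finset.sum_congr rfl fun j _ => ?_
  rw [incMinus, map_sum]
  refine Finset.sum_congr rfl fun i hi => ?_
  rw [(Finset.mem_filter.1 hi).2]

/-! ### The geometry of a strut -/

theorem norm_tangent {i : Fin nE} {s : ℝ} (hs : s ∈ Icc 0 (S.len i)) : ‖S.tangent i s‖ = 1 := by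
  have h := congrFun (congrFun (S.transpose_mul_Q hs) 0) 0
  rw [Matrix.mul_apply, Matrix.one_apply_eq] at h
  rw [← sq_eq_sq₀ (norm_nonneg _) zero_le_one, one_pow, EuclideanSpace.norm_sq_eq, ← h]
  refine Finset.sum_congr rfl fun k _ => ?_
  simp [tangent, sq]

/-- Fundamental theorem of calculus for $\Phi\times P$. The tangent need not be continuous: `Φ` is
differentiable everywhere and the derivative is integrable. -/
theorem integral_cross_tangent {i : Fin nE} {s : ℝ} (hs : s ∈ Icc 0 (S.len i)) (P : R3) :
    ∫ x in (0 : ℝ)..s, cross (S.tangent i x) P = cross (S.Φ i s - S.Φ i 0) P := by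
  set T : R3 →L[ℝ] R3 := LinearMap.toContinuousLinearMap
    ((ContinuousLinearMap.coeLM ℝ).comp crossL |>.flip P)
  have hTa : ∀ x, T x = cross x P := fun x => rfl
  have hsub : Icc 0 s ⊆ Icc 0 (S.len i) := Icc_subset_Icc_right hs.2
  have hd : ∀ x ∈ Icc 0 s, HasDerivWithinAt (fun x => T (S.Φ i x)) (T (S.tangent i x))
      (Icc 0 s) x := fun x hx =>
    T.hasFDerivAt.comp_hasDerivWithinAt x ((S.Φ_deriv i x (hsub hx)).mono hsub)
  have hint : IntegrableOn (fun x => T (S.tangent i x)) (Ioo 0 (S.len i)) := by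
    refine (integrable_L2 (S.crossT i (constL _ P))).congr ?_
    filter_upwards [S.coeFn_crossT (constL (S.len i) P), coeFn_constL (S.len i) P] with x h1 h2
    rw [h1, h2, hTa]
  have h := intervalIntegral.integral_eq_sub_of_hasDerivAt_of_le hs.1
    (fun x hx => (hd x hx).continuousWithinAt)
    (fun x hx => (hd x (Ioo_subset_Icc_self hx)).hasDerivAt (Icc_mem_nhds hx.1 hx.2))
    ((intervalIntegrable_iff_integrableOn_Ioo_of_le hs.1).2
      (hint.mono_set (Ioo_subset_Ioo_right hs.2)))
  rw [← map_sub] at h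
  exact h

theorem integralL_crossT_constL (i : Fin nE) (P : R3) :
    integralL _ (S.crossT i (constL _ P))
      = crossL (S.vertex (S.head i)) P - crossL (S.vertex (S.tail i)) P := by
  have h := S.integral_cross_tangent (i := i) ⟨(S.len_pos i).le, le_rfl⟩ P
  rw [S.Φ_len, S.Φ_zero, intervalIntegral.integral_of_le (S.len_pos i).le,
    integral_Ioc_eq_integral_Ioo, ← crossL_apply, map_sub, sub_apply] at h
  rw [← h, integralL_apply]
  refine integral_congr_ae ?_
  filter_upwards [S.coeFn_crossT (constL (S.len i) P), coeFn_constL (S.len i) P] with x h1 h2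
  rw [h1, h2]

/-- A strut that is almost everywhere tangent to a fixed nonzero vector is straight. -/
theorem isStraight_of_cross_eq_zero {i : Fin nE} {P : R3} (hP : P ≠ 0)
    (h : ∀ᵐ s ∂(intervalMeasure (S.len i)), cross (S.tangent i s) P = 0) :
    S.IsStraight i ∧ ∃ c : ℝ, P = c • S.tangent i 0 := by
  have hl := S.len_pos i
  have h0 : (0 : ℝ) ∈ Icc 0 (S.len i) := ⟨le_rfl, hl.le⟩
  set r : ℝ → ℝ := fun s => (inner ℝ (S.Φ i s - S.Φ i 0) P : ℝ) / ‖P‖ ^ 2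
  set r' : ℝ → ℝ := fun s => (inner ℝ (S.tangent i s) P : ℝ) / ‖P‖ ^ 2
  -- Integrating the condition passes from almost every to every `s`: the curve lies on a line.
  have hΦ : ∀ s ∈ Icc 0 (S.len i), S.Φ i s - S.Φ i 0 = r s • P := by
    intro s hs
    refine eq_smul_of_cross_eq_zero hP ?_
    rw [← S.integral_cross_tangent hs P, intervalIntegral.integral_of_le hs.1,
      integral_Ioc_eq_integral_Ioo]
    refine integral_eq_zero_of_ae ?_
    exact ae_restrict_of_ae_restrict_of_subset (Ioo_subset_Ioo_right hs.2) h
  have hderiv : ∀ s ∈ Icc 0 (S.len i), HasDerivWithinAt (fun s => S.Φ i s - S.Φ i 0)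
      (S.tangent i s) (Icc 0 (S.len i)) s := fun s hs => (S.Φ_deriv i s hs).sub_const _
  have hrd : ∀ s ∈ Icc 0 (S.len i), HasDerivWithinAt r (r' s) (Icc 0 (S.len i)) s := by
    intro s hs
    have := ((hderiv s hs).inner ℝ (hasDerivWithinAt_const s _ P)).div_const (‖P‖ ^ 2)
    simpa only [inner_zero_right, zero_add] using this
  have ht : ∀ s ∈ Icc 0 (S.len i), S.tangent i s = r' s • P := by
    intro s hs
    have h1 : HasDerivWithinAt (fun s => S.Φ i s - S.Φ i 0) (r' s • P) (Icc 0 (S.len i)) s :=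
      ((hrd s hs).smul_const P).congr hΦ (hΦ s hs)
    exact (uniqueDiffOn_Icc hl s hs).eq_deriv _ (hderiv s hs) h1
  have hn : ∀ s ∈ Icc 0 (S.len i), |r' s| * ‖P‖ = 1 := by
    intro s hs
    rw [← S.norm_tangent hs, ht s hs, norm_smul, Real.norm_eq_abs]
  have hne : ∀ s ∈ Icc 0 (S.len i), r' s ≠ 0 := by
    intro s hs h1
    have := hn s hs
    rw [h1, abs_zero, zero_mul] at this
    exact zero_ne_one this
  have habs : ∀ s ∈ Icc 0 (S.len i), |r' s| = |r' 0| := fun s hs =>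
    mul_right_cancel₀ (norm_ne_zero_iff.2 hP) ((hn s hs).trans (hn 0 h0).symm)
  -- The unit tangent fixes `|r'|`. Being a nowhere zero derivative, `r'` keeps its sign by Darboux,
  -- so the curve cannot turn back.
  have hconst : ∀ s ∈ Icc 0 (S.len i), r' s = r' 0 := by
    intro s hs
    have h1 := habs s hs
    rcases hasDerivWithinAt_forall_lt_or_forall_gt_of_forall_ne (convex_Icc 0 (S.len i)) hrd hne
      with h2 | h2
    · rwa [abs_of_neg (h2 s hs), abs_of_neg (h2 0 h0), neg_inj] at h1
    · rwa [abs_of_pos (h2 s hs), abs_of_pos (h2 0 h0)] at h1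
  refine ⟨⟨S.tangent i 0, fun s hs => ?_⟩, (r' 0)⁻¹, ?_⟩
  · have hz : ∀ x ∈ Icc 0 (S.len i), HasDerivWithinAt (fun x => S.Φ i x - x • S.tangent i 0) 0
        (Icc 0 (S.len i)) x := by
      intro x hx
      have h1 := (S.Φ_deriv i x hx).sub ((hasDerivWithinAt_id x _).smul_const (S.tangent i 0))
      have h2 : (WithLp.toLp 2 fun k => S.Q i x k 0 : R3) = S.tangent i 0 := by
        change S.tangent i x = S.tangent i 0
        rw [ht x hx, ht 0 h0, hconst x hx]
      rw [h2, one_smul, sub_self] at h1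
      exact h1
    have h3 := constant_of_has_deriv_right_zero (fun x hx => (hz x hx).continuousWithinAt)
      (fun x hx => (hz x (Ico_subset_Icc_self hx)).mono_of_mem_nhdsWithin
        (Icc_mem_nhdsGE_of_mem hx)) s hs
    rw [zero_smul, sub_zero] at h3
    exact sub_eq_iff_eq_add.1 h3
  · rw [ht 0 h0, smul_smul, inv_mul_cancel₀ (hne 0 h0), one_smul]

/-- The forces are axial and vanish on curved edges, so vertex balance reduces to a sum over
straight edges. -/
theorem eq_zero_of_balance_of_cross_eq_zero (hgeom : S.StraightCondition) {P : Fin nE → R3}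
    (hbal : ∀ j, S.incPlus P j = S.incMinus P j)
    (h : ∀ i, ∀ᵐ s ∂(intervalMeasure (S.len i)), cross (S.tangent i s) (P i) = 0) : P = 0 := by
  have h1 : ∀ i, ∃ c : ℝ, P i = c • S.tangent i 0 ∧ (¬ S.IsStraight i → P i = 0) := by
    intro i
    by_cases hP : P i = 0
    · exact ⟨0, by rw [hP, zero_smul], fun _ => hP⟩
    · obtain ⟨hs, c, hc⟩ := S.isStraight_of_cross_eq_zero hP (h i)
      exact ⟨c, hc, fun hn => absurd hs hn⟩
  choose c hc hc0 using h1
  classical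
  have hz := hgeom c (fun j => by
    rw [sub_eq_zero]
    refine Eq.trans ?_ ((hbal j).trans ?_)
    · rw [incPlus]
      simp only [← hc]
      refine Finset.sum_subset (fun i hi => ?_) fun i hi hi' => ?_
      · rw [Finset.mem_filter] at hi ⊢
        exact ⟨hi.1, hi.2.1⟩
      · rw [Finset.mem_filter] at hi hi'
        exact hc0 i fun hs => hi' ⟨hi.1, hi.2, hs⟩
    · rw [incMinus]
      simp only [← hc]
      refine (Finset.sum_subset (fun i hi => ?_) fun i hi hi' => ?_).symm
      · rw [Finset.mem_filter] at hi ⊢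
        exact ⟨hi.1, hi.2.1⟩
      · rw [Finset.mem_filter] at hi hi'
        exact hc0 i fun hs => hi' ⟨hi.1, hi.2, hs⟩)
  funext i
  by_cases hs : S.IsStraight i
  · rw [hc i, hz i hs, zero_smul, Pi.zero_apply]
  · exact hc0 i hs

/-! ### Uniqueness for the homogeneous equations -/

theorem kinematics_eq_zero (hE : 0 < nE) (hconn : S.graph.Connected) {U : Fin nV → R3}
    (h : ∀ i, U (S.tail i) = U (S.head i))
    (hU : ∑ i, integralL (S.len i) (constL _ (U (S.tail i))) = 0) : U = 0 := by
  have hc := S.eq_of_connected hconn h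
  funext j
  refine S.eq_zero_of_sum_len_smul hE (Eq.trans ?_ hU)
  refine Finset.sum_congr rfl fun i _ => ?_
  rw [integralL_constL (S.len_pos i).le, hc (S.tail i) j]

theorem statics_eq_zero (hE : 0 < nE) (hgeom : S.StraightCondition) {P Q : Fin nE → R3} {α β : R3}
    (hbal : ∀ j, S.incPlus (fun i => P i - integralL _ (constL (S.len i) α)) j = S.incMinus P j)
    (hq : ∀ i, constL _ (Q i) - primitiveL _ (constL _ β
      + S.crossT i (constL _ (P i) - primitiveL _ (constL _ α))) = 0) :
    P = 0 ∧ Q = 0 ∧ α = 0 ∧ β = 0 := by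
  -- Summed over all vertices, incoming and outgoing forces both run over every edge; only the total
  -- length times `α` is left.
  have hα : α = 0 := by
    refine S.eq_zero_of_sum_len_smul hE ?_
    have h := Finset.sum_congr rfl fun j (_ : j ∈ Finset.univ) => hbal j
    rw [sum_incPlus, sum_incMinus, Finset.sum_sub_distrib, sub_eq_self] at h
    refine Eq.trans (Finset.sum_congr rfl fun i _ => ?_) h
    rw [integralL_constL (S.len_pos i).le]
  subst hα
  simp only [map_zero, sub_zero] at hbal hq
  have hq' : ∀ i, Q i = 0 ∧ -(constL _ β + S.crossT i (constL _ (P i))) = 0 := fun i =>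
    constL_add_primitiveL_eq_zero (S.len_pos i) (by rw [map_neg, ← sub_eq_add_neg, hq i])
  -- Integrating $\beta+t\times P=0$ over an edge gives the difference of the moments of `P` at its
  -- ends; these cancel in the sum over all edges.
  have hβ : β = 0 := by
    refine S.eq_zero_of_sum_len_smul hE ?_
    have h : ∀ i, S.len i • β
        = crossL (S.vertex (S.tail i)) (P i) - crossL (S.vertex (S.head i)) (P i) := by
      intro i
      have := congrArg (integralL _) (neg_eq_zero.1 (hq' i).2)
      rw [map_add, map_zero, integralL_constL (S.len_pos i).le, integralL_crossT_constL] at this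
      rw [eq_neg_of_add_eq_zero_left this, neg_sub]
    rw [Finset.sum_congr rfl fun i _ => h i, Finset.sum_sub_distrib, ← sum_cross_incMinus,
      ← sum_cross_incPlus, sub_eq_zero]
    exact Finset.sum_congr rfl fun j _ => by rw [← hbal j]
  subst hβ
  refine ⟨S.eq_zero_of_balance_of_cross_eq_zero hgeom hbal fun i => ?_,
    funext fun i => (hq' i).1, rfl, rfl⟩
  have h := (hq' i).2
  rw [map_zero, zero_add, neg_eq_zero] at h
  have hc := S.coeFn_crossT (constL (S.len i) (P i))
  rw [h] at hc
  filter_upwards [hc, coeFn_constL (S.len i) (P i),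
    Lp.coeFn_zero R3 2 (intervalMeasure (S.len i))] with s h1 h2 h3
  rw [← h2, ← h1, h3, Pi.zero_apply]

/-! ### Solutions in terms of initial values -/

/-- The values `(P₋, Q₋, U, W, α, β)`, which determine a solution. -/
abbrev Param (nV nE : ℕ) : Type :=
  (Fin nE → R3) × (Fin nE → R3) × (Fin nV → R3) × (Fin nV → R3) × R3 × R3

/-- The parameters together with the load density. -/
abbrev Data : Type := Param nV nE × (∀ i, L2 (S.len i))

/-- The total line density of forces. -/
def forceDensity (i : Fin nE) : S.Data →ₗ[ℝ] L2 (S.len i) where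
  toFun y := constL _ y.1.2.2.2.2.1 + y.2 i
  map_add' y z := by simp; abel
  map_smul' c y := by simp

/-- The contact force. -/
def forceMap (i : Fin nE) : S.Data →ₗ[ℝ] L2 (S.len i) where
  toFun y := constL _ (y.1.1 i) - primitiveL _ (S.forceDensity i y)
  map_add' y z := by simp; abel
  map_smul' c y := by simp [smul_sub]

/-- The total line density of couples. -/
def coupleDensity (i : Fin nE) : S.Data →ₗ[ℝ] L2 (S.len i) where
  toFun y := constL _ y.1.2.2.2.2.2 + S.crossT i (S.forceMap i y)
  map_add' y z := by simp; abel
  map_smul' c y := by simp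

/-- The contact couple. -/
def coupleMap (i : Fin nE) : S.Data →ₗ[ℝ] L2 (S.len i) where
  toFun y := constL _ (y.1.2.1 i) - primitiveL _ (S.coupleDensity i y)
  map_add' y z := by simp; abel
  map_smul' c y := by simp [smul_sub]

/-- The infinitesimal rotation of the cross-sections. -/
def rotationMap (i : Fin nE) : S.Data →ₗ[ℝ] L2 (S.len i) where
  toFun y := constL _ (y.1.2.2.2.1 (S.tail i))
    + primitiveL _ (S.compliance i (S.coupleMap i y))
  map_add' y z := by simp; abel
  map_smul' c y := by simp

/-- The displacement of the middle curve. -/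
def displacementMap (i : Fin nE) : S.Data →ₗ[ℝ] L2 (S.len i) where
  toFun y := constL _ (y.1.2.2.1 (S.tail i))
    + primitiveL _ (-S.crossT i (S.rotationMap i y))
  map_add' y z := by simp; abel
  map_smul' c y := by simp

/-- The residuals of the remaining conditions: continuity at the heads of the edges, the balance of
forces and couples at the vertices, and the vanishing of the mean values. -/
def residual : S.Data →ₗ[ℝ] Param nV nE where
  toFun y :=
    (fun i => y.1.2.2.1 (S.tail i) + integralL _ (-S.crossT i (S.rotationMap i y))
        - y.1.2.2.1 (S.head i),
     fun i => y.1.2.2.2.1 (S.tail i) + integralL _ (S.compliance i (S.coupleMap i y))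
        - y.1.2.2.2.1 (S.head i),
     fun j => S.incPlus (fun i => y.1.1 i - integralL _ (S.forceDensity i y)) j
        - S.incMinus y.1.1 j,
     fun j => S.incPlus (fun i => y.1.2.1 i - integralL _ (S.coupleDensity i y)) j
        - S.incMinus y.1.2.1 j,
     ∑ i, integralL _ (S.displacementMap i y), ∑ i, integralL _ (S.rotationMap i y))
  map_add' y z := by
    refine Prod.ext (funext fun i => ?_) (Prod.ext (funext fun i => ?_)
      (Prod.ext (funext fun j => ?_) (Prod.ext (funext fun j => ?_) (Prod.ext ?_ ?_))))
    · simp; abel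
    · simp; abel
    · simp [incPlus, incMinus, Finset.sum_add_distrib]; abel
    · simp [incPlus, incMinus, Finset.sum_add_distrib]; abel
    · simp [Finset.sum_add_distrib]
    · simp [Finset.sum_add_distrib]
  map_smul' c y := by
    refine Prod.ext (funext fun i => ?_) (Prod.ext (funext fun i => ?_)
      (Prod.ext (funext fun j => ?_) (Prod.ext (funext fun j => ?_) (Prod.ext ?_ ?_))))
    · simp [smul_sub]
    · simp [smul_sub]
    · simp [incPlus, incMinus, smul_sub, Finset.smul_sum]
    · simp [incPlus, incMinus, smul_sub, Finset.smul_sum]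
    · simp [Finset.smul_sum]
    · simp [Finset.smul_sum]

/-- The stress variables determined by the data. -/
def stressOf (y : S.Data) : S.V where
  q i := S.coupleMap i y
  p i := S.forceMap i y
  Pp i := y.1.1 i - integralL _ (S.forceDensity i y)
  Pm := y.1.1
  Qp i := y.1.2.1 i - integralL _ (S.coupleDensity i y)
  Qm := y.1.2.1
  α := y.1.2.2.2.2.1
  β := y.1.2.2.2.2.2

/-- The kinematic variables determined by the data. -/
def kinematicsOf (y : S.Data) : S.M where
  u i := ofDeriv (y.1.2.2.1 (S.tail i)) (-S.crossT i (S.rotationMap i y))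
  w i := ofDeriv (y.1.2.2.2.1 (S.tail i)) (S.compliance i (S.coupleMap i y))
  U := y.1.2.2.1
  W := y.1.2.2.2.1

theorem isSolution_of_residual_eq_zero {x : Param nV nE} {f : ∀ i, L2 (S.len i)}
    (h : S.residual (x, f) = 0) :
    S.IsSolution f (S.stressOf (x, f)) (S.kinematicsOf (x, f)) := by
  simp only [residual, LinearMap.coe_mk, AddHom.coe_mk, Prod.mk_eq_zero, funext_iff,
    Pi.zero_apply, sub_eq_zero] at h
  obtain ⟨h1, h2, h3, h4, h5, h6⟩ := h
  constructor
  · refine (S.forall_a_add_b_iff _ _).2 ⟨fun i => ⟨weakDeriv_ofDeriv _ _, weakDeriv_ofDeriv _ _,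
      ?_, rep_ofDeriv_zero (S.len_pos i) _ _, ?_, rep_ofDeriv_zero (S.len_pos i) _ _⟩, h5, h6⟩
    · exact (rep_ofDeriv_length (S.len_pos i) _ _).trans (h1 i)
    · exact (rep_ofDeriv_length (S.len_pos i) _ _).trans (h2 i)
  · exact (S.forall_b_eq_load_iff f _).2 ⟨fun i => ⟨rfl, rfl, rfl, rfl⟩, h3, h4⟩

/-- The strong equations are triangular: each field is recovered from its initial value and the
preceding fields. -/
theorem exists_param_of_isSolution {f : ∀ i, L2 (S.len i)} {σ : S.V} {φ : S.M}
    (h : S.IsSolution f σ φ) :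
    ∃ x : Param nV nE, S.residual (x, f) = 0 ∧
      σ = S.stressOf (x, f) ∧ φ = S.kinematicsOf (x, f) := by
  obtain ⟨hk, hu, hw⟩ := (S.forall_a_add_b_iff σ φ).1 h.1
  obtain ⟨hs, hP, hQ⟩ := (S.forall_b_eq_load_iff f σ).1 h.2
  set y : S.Data := ((σ.Pm, σ.Qm, φ.U, φ.W, σ.α, σ.β), f)
  have hp : ∀ i, σ.p i = S.forceMap i y := fun i => (hs i).1
  have hcd : ∀ i, constL _ σ.β + S.crossT i (σ.p i) = S.coupleDensity i y := fun i => by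
    rw [hp]; rfl
  have hq : ∀ i, σ.q i = S.coupleMap i y := fun i => by
    rw [(hs i).2.2.1, hcd]; rfl
  have hPp : σ.Pp = fun i => σ.Pm i - integralL _ (S.forceDensity i y) :=
    funext fun i => (hs i).2.1
  have hQp : σ.Qp = fun i => σ.Qm i - integralL _ (S.coupleDensity i y) :=
    funext fun i => by rw [(hs i).2.2.2, hcd]
  have hwo : ∀ i, φ.w i = ofDeriv (φ.W (S.tail i)) (S.compliance i (S.coupleMap i y)) := by
    intro i
    obtain ⟨e1, -, -, -, -, e6⟩ := hk i
    rw [← hq, ← e1, ← e6]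
    exact eq_ofDeriv (S.len_pos i) _
  have hwc : ∀ i, (φ.w i : L2 (S.len i)) = S.rotationMap i y := fun i => by rw [hwo]; rfl
  have huo : ∀ i, φ.u i = ofDeriv (φ.U (S.tail i)) (-S.crossT i (S.rotationMap i y)) := by
    intro i
    obtain ⟨-, e2, -, e4, -, -⟩ := hk i
    rw [← hwc, ← e2, ← e4]
    exact eq_ofDeriv (S.len_pos i) _
  have huc : ∀ i, (φ.u i : L2 (S.len i)) = S.displacementMap i y := fun i => by rw [huo]; rfl
  refine ⟨y.1, ?_, ?_, ?_⟩
  · simp only [residual, LinearMap.coe_mk, AddHom.coe_mk, Prod.mk_eq_zero, funext_iff,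
      Pi.zero_apply, sub_eq_zero]
    refine ⟨fun i => ?_, fun i => ?_, fun j => ?_, fun j => ?_, ?_, ?_⟩
    · exact (rep_ofDeriv_length (S.len_pos i) _ _).symm.trans ((huo i) ▸ (hk i).2.2.1)
    · exact (rep_ofDeriv_length (S.len_pos i) _ _).symm.trans ((hwo i) ▸ (hk i).2.2.2.2.1)
    · rw [← hPp]; exact hP j
    · rw [← hQp]; exact hQ j
    · rw [← hu]; exact Finset.sum_congr rfl fun i _ => by rw [huc]
    · rw [← hw]; exact Finset.sum_congr rfl fun i _ => by rw [hwc]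
  · exact V.ext (funext hq) (funext hp) hPp rfl hQp rfl rfl rfl
  · exact M.ext (funext huo) (funext hwo) rfl rfl

theorem param_eq_zero (hE : 0 < nE) (hconn : S.graph.Connected) (hgeom : S.StraightCondition)
    {x : Param nV nE} (h : S.residual (x, 0) = 0) : x = 0 := by
  have hsol := S.isSolution_of_residual_eq_zero h
  -- Energy identity: $a(\Sigma,\Sigma)=-b(\Sigma,\varphi)=-F(\varphi)=0$.
  have ha : S.a (S.stressOf (x, 0)) (S.stressOf (x, 0)) = 0 := by
    have h1 := hsol.1 (S.stressOf (x, 0))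
    rw [hsol.2, load_eq] at h1
    simpa using h1
  rw [a_eq, Finset.sum_eq_zero_iff_of_nonneg fun i _ => S.inner_compliance_nonneg _] at ha
  have hq : ∀ i, S.coupleMap i (x, 0) = 0 := fun i =>
    S.eq_zero_of_inner_compliance _ (ha i (Finset.mem_univ i)).le
  simp only [residual, LinearMap.coe_mk, AddHom.coe_mk, Prod.mk_eq_zero, funext_iff,
    Pi.zero_apply, sub_eq_zero, hq, map_zero, add_zero] at h
  obtain ⟨h1, h2, h3, h4, h5, h6⟩ := h
  have hrot : ∀ i, S.rotationMap i (x, 0) = constL _ (x.2.2.2.1 (S.tail i)) := fun i => by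
    simp [rotationMap, hq]
  simp only [hrot] at h1 h6
  -- Rotations come first: displacements are constant along edges only once `W` vanishes.
  have hW := S.kinematics_eq_zero hE hconn h2 h6
  have hU := S.kinematics_eq_zero hE hconn (U := x.2.2.1) (fun i => by simpa [hW] using h1 i) (by
    refine Eq.trans (Finset.sum_congr rfl fun i _ => ?_) h5
    simp [displacementMap, hrot, hW])
  have hfd : ∀ i, S.forceDensity i (x, 0) = constL _ x.2.2.2.2.1 := fun i => by
    simp [forceDensity]
  simp only [hfd] at h3
  obtain ⟨hP, hQ, hα, hβ⟩ := S.statics_eq_zero hE hgeom (Q := x.2.1) (β := x.2.2.2.2.2) h3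
    (fun i => by
      rw [← hfd]
      exact hq i)
  exact Prod.ext hP (Prod.ext hQ (Prod.ext hU (Prod.ext hW (Prod.ext hα hβ))))

end Stent

end StentModel

end

/-! ### Existence and uniqueness -/

theorem theorem3p6 {nV nE : ℕ} (S : StentModel.Stent nV nE) (hE : 0 < nE)
    (hconn : S.graph.Connected) (hgeom : S.StraightCondition)
    (f : ∀ i, StentModel.L2 (S.len i)) :
    ∃! x : S.V × S.M, S.IsSolution f x.1 x.2 := by
  set T := S.residual ∘ₗ
    LinearMap.inl ℝ (StentModel.Stent.Param nV nE) (∀ i, StentModel.L2 (S.len i))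
  have hT : Function.Injective T := (injective_iff_map_eq_zero T).2 fun x hx =>
    S.param_eq_zero hE hconn hgeom hx
  have hsplit : ∀ x, S.residual (x, f) = T x + S.residual (0, f) := fun x => by
    change _ = S.residual (x, 0) + _
    rw [← map_add, Prod.mk_add_mk, add_zero, zero_add]
  -- `T` is an endomorphism of a finite-dimensional space, so its injectivity yields a parameter
  -- that cancels the residual of the load.
  obtain ⟨x, hx⟩ := LinearMap.injective_iff_surjective.1 hT (-S.residual (0, f))
  refine ⟨(S.stressOf (x, f), S.kinematicsOf (x, f)),
    S.isSolution_of_residual_eq_zero (by rw [hsplit, hx, neg_add_cancel]), ?_⟩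
  rintro ⟨σ, φ⟩ hsol
  obtain ⟨z, hz, rfl, rfl⟩ := S.exists_param_of_isSolution hsol
  rw [hsplit, ← eq_neg_iff_add_eq_zero] at hz
  rw [hT (hz.trans hx.symm)]
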